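/- Let $A$ be a finite alphabet, let $X=A^{\mathbb Z^2}$ carry the product topology and product $\sigma$-algebra, and let $\sigma_1,\sigma_2$ be the horizontal and vertical shifts, $(\sigma_1x)_{(i,j)}=x_{(i+1,j)}$, $(\sigma_2x)_{(i,j)}=x_{(i,j+1)}$. Let $F:X\to X$ be a two-dimensional cellular automaton, that is, a continuous map commuting with $\sigma_1$ and $\sigma_2$, and let $\mu$ be an $F$-invariant probability measure on $X$ that is invariant and ergodic for the $\mathbb Z^2$-action generated by $\sigma_1,\sigma_2$. For a finite measurable partition $\alpha$ put $H_\mu(\alpha)=-\sum_{B\in\alpha}\mu(B)\log\mu(B)$, $$h_\mu(F,\alpha)=\lim_{m\to\infty}\tfrac1m H_\mu\Big(\bigvee_{k=0}^{m-1}F^{-k}\alpha\Big),\qquad h_\mu(\sigma_1,\sigma_2,\alpha)=\lim_{n\to\infty}\tfrac1{n^2}H_\mu\Big(\bigvee_{0\le i,j<n}\sigma_1^{-i}\sigma_2^{-j}\alpha\Big),$$ and let $h_\mu(\sigma_1,\sigma_2)=\sup_\alpha h_\mu(\sigma_1,\sigma_2,\alpha)$. Let $\alpha_n$ be the partition of $X$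 according to the coordinates $(i,j)$ with $0\le i,j\le n$, let $\alpha_*$ be the partition according to the coordinate $(0,0)$, and define the always finite entropy $$h^{2D}_\mu(F)=\liminf_{n\to\infty}\tfrac1n h_\mu(F,\alpha_n).$$ For $\theta\in\mathbb R$ and $p=(i,j)\in\mathbb Z^2$ let $W^\theta_p\subset\mathbb Z^2$ be the lattice half plane $$W^\theta_p=\{(\lfloor s\rfloor,\lfloor t\rfloor): s,t\in\mathbb R,\ s\cos\theta+t\sin\theta\le i\cos\theta+j\sin\theta\},$$ and let $W^\theta_p(x)$ be the set of $y\in X$ that agree with $x$ on $W^\theta_p$. Put $$\Lambda_n^F(\theta)(x)=\min\Big\{\sqrt{i^2+j^2}: p=(i,j)\in\mathbb Z^2,\ i\cos\theta+j\sin\theta\ge0,\ F^k(W^\theta_p(x))\subset W^\theta_{(0,0)}(F^k x)\ \text{for all } 1\le k\le n\Big\},$$ $\Lambda_n^F(\theta)=\max_{x\in X}\Lambda_n^F(\theta)(x)$ and $\lambda(\theta)=\lim_{n\to\infty}\Lambda_n^F(\theta)/n$ (the directional Lyapunov exponent in direction $\theta$). Then all these limits, minima and maxima exist, $\lambda$ is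 continuous, and $$h^{2D}_\mu(F)\le h_\mu(\sigma_1,\sigma_2)\left(\int_0^{2\pi}\frac{\lambda(\theta)^2}{2}\,d\theta+\sqrt2\int_0^{\pi}\lambda(\theta)\,d\theta+\pi\right);$$ the same inequality holds with $h_\mu(\sigma_1,\sigma_2,\alpha_*)$ in place of $h_\mu(\sigma_1,\sigma_2)$, and in particular $h^{2D}_\mu(F)<\infty$. -/

import Mathlib

open Filter Topology MeasureTheory

noncomputable section

namespace CA2D

/-- Configurations of the two-dimensional lattice over the alphabet `A`, with the product
topology and the product sigma-algebra. -/
abbrev Config (A : Type*) := ℤ × ℤ → A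

/-- Horizontal shift. -/
def shift₁ {A : Type*} (x : Config A) : Config A := fun p => x (p.1 + 1, p.2)

/-- Vertical shift. -/
def shift₂ {A : Type*} (x : Config A) : Config A := fun p => x (p.1, p.2 + 1)

/-- A two-dimensional cellular automaton: a continuous self-map commuting with both shifts. -/
structure IsCellularAutomaton {A : Type*} [TopologicalSpace A] (F : Config A → Config A) :
    Prop where
  continuous : Continuous F
  comm₁ : ∀ x, F (shift₁ x) = shift₁ (F x)
  comm₂ : ∀ x, F (shift₂ x) = shift₂ (F x)

/-- `μ` is invariant and ergodic for the action of `ℤ²` generated by the two shifts. -/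
structure IsShiftErgodic {A : Type*} [MeasurableSpace A] (μ : Measure (Config A)) : Prop where
  measurePreserving₁ : MeasurePreserving (shift₁ (A := A)) μ μ
  measurePreserving₂ : MeasurePreserving (shift₂ (A := A)) μ μ
  ergodic : ∀ B : Set (Config A), MeasurableSet B →
    shift₁ ⁻¹' B = B → shift₂ ⁻¹' B = B → μ B = 0 ∨ μ B = 1

/-! ### Entropies

A finite partition is given by a map `f` into a finite type, its atoms being the fibres of `f`;
the join of a finite family of partitions is given by the tuple of the maps. -/

/-- `H_μ(α) = - ∑ μ(B) log μ(B)` for the partition `α` into the fibres of `f`. -/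
def partitionEntropy {X ι : Type*} [MeasurableSpace X] [Fintype ι] (μ : Measure X) (f : X → ι) :
    ℝ :=
  ∑ b : ι, Real.negMulLog (μ.real (f ⁻¹' {b}))

/-- `(1/m) H_μ(α ∨ T⁻¹α ∨ ⋯ ∨ T^{-(m-1)}α)`. -/
def entropySeq {X ι : Type*} [MeasurableSpace X] [Fintype ι] (μ : Measure X) (T : X → X)
    (f : X → ι) (m : ℕ) : ℝ :=
  partitionEntropy μ (fun x (k : Fin m) => f (T^[(k : ℕ)] x)) / m

/-- `h_μ(T, α)`. -/
def entropyOf {X ι : Type*} [MeasurableSpace X] [Fintype ι] (μ : Measure X) (T : X → X)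
    (f : X → ι) : ℝ :=
  limUnder atTop (entropySeq μ T f)

/-- The partition `α_n` into the cylinders fixing the coordinates `(i,j)`, `0 ≤ i, j ≤ n`. -/
def squarePartition {A : Type*} (n : ℕ) (x : Config A) : Fin (n + 1) × Fin (n + 1) → A :=
  fun q => x (((q.1 : ℕ) : ℤ), ((q.2 : ℕ) : ℤ))

/-- The always finite entropy `h^{2D}_μ(F) = liminf (1/n) h_μ(F, α_n)`, as an extended real. -/
def alwaysFiniteEntropy {A : Type*} [Fintype A] [MeasurableSpace A] (μ : Measure (Config A))
    (F : Config A → Config A) : EReal :=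
  liminf (fun n : ℕ => ((entropyOf μ F (squarePartition n) / n : ℝ) : EReal)) atTop

/-- `(1/n²) H_μ(⋁_{0 ≤ i, j < n} σ₁^{-i} σ₂^{-j} α)`. -/
def shiftEntropySeq {A ι : Type*} [MeasurableSpace A] [Fintype ι] (μ : Measure (Config A))
    (f : Config A → ι) (n : ℕ) : ℝ :=
  partitionEntropy μ
    (fun x (q : Fin n × Fin n) => f (shift₁^[(q.1 : ℕ)] (shift₂^[(q.2 : ℕ)] x))) / (n : ℝ) ^ 2

/-- `h_μ(σ₁, σ₂, α)`. -/
def shiftEntropyOf {A ι : Type*} [MeasurableSpace A] [Fintype ι] (μ : Measure (Config A))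
    (f : Config A → ι) : ℝ :=
  limUnder atTop (shiftEntropySeq μ f)

/-- The entropy `h_μ(σ₁, σ₂)` of the `ℤ²`-action: the supremum of `h_μ(σ₁, σ₂, α)` over all
finite measurable partitions `α`. -/
def shiftEntropy {A : Type*} [MeasurableSpace A] (μ : Measure (Config A)) : EReal :=
  ⨆ (m : ℕ) (f : {f : Config A → Fin m // Measurable f}), ((shiftEntropyOf μ f.1 : ℝ) : EReal)

/-- The partition `α_1` by the central coordinate. -/
def centralPartition {A : Type*} (x : Config A) : A := x (0, 0)

/-! ### Directional Lyapunov exponents -/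

/-- The lattice half plane `W^θ_p`: the integer parts `(⌊s⌋, ⌊t⌋)` of the points `(s, t)` of the
closed real half plane that is bounded by the line through `p` making the angle `θ` with the
vertical, and that has outer normal `(cos θ, sin θ)`. Its boundary is the almost line through `p`,
that is, the set of integer parts of the points of the real line. -/
def halfPlane (θ : ℝ) (p : ℤ × ℤ) : Set (ℤ × ℤ) :=
  {q | ∃ s t : ℝ, s * Real.cos θ + t * Real.sin θ ≤ p.1 * Real.cos θ + p.2 * Real.sin θ ∧
    q = (⌊s⌋, ⌊t⌋)}

/-- `W^θ_p(x)`: the configurations that agree with `x` on `W^θ_p`. -/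
def agreeSet {A : Type*} (θ : ℝ) (p : ℤ × ℤ) (x : Config A) : Set (Config A) :=
  {y | ∀ q ∈ halfPlane θ p, y q = x q}

/-- The values `s = √(i² + j²)`, for `(i,j)` such that the half plane bounded by the line
through `(i,j)` contains the origin and `F^k(W^θ_{(i,j)}(x)) ⊆ W^θ_{(0,0)}(F^k x)` for all
`1 ≤ k ≤ n`. -/
def propagationRadii {A : Type*} (F : Config A → Config A) (n : ℕ) (θ : ℝ) (x : Config A) :
    Set ℝ :=
  {s | ∃ p : ℤ × ℤ, 0 ≤ p.1 * Real.cos θ + p.2 * Real.sin θ ∧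
    s = Real.sqrt ((p.1 : ℝ) ^ 2 + (p.2 : ℝ) ^ 2) ∧
    ∀ k : ℕ, 1 ≤ k → k ≤ n → F^[k] '' agreeSet θ p x ⊆ agreeSet θ (0, 0) (F^[k] x)}

/-- `Λ_n^F(θ)(x)`, the minimum of `propagationRadii F n θ x`. -/
def propagationAt {A : Type*} (F : Config A → Config A) (n : ℕ) (θ : ℝ) (x : Config A) : ℝ :=
  sInf (propagationRadii F n θ x)

/-- `Λ_n^F(θ)`, the maximum over all configurations `x` of `Λ_n^F(θ)(x)`. -/
def propagation {A : Type*} (F : Config A → Config A) (n : ℕ) (θ : ℝ) : ℝ :=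
  sSup (Set.range (propagationAt F n θ))

/-- The directional Lyapunov exponent `λ(θ) = lim Λ_n^F(θ) / n`. -/
def lyapunov {A : Type*} (F : Config A → Config A) (θ : ℝ) : ℝ :=
  limUnder atTop (fun n : ℕ => propagation F n θ / n)

/-- `∫_0^{2π} λ(θ)²/2 dθ + √2 ∫_0^π λ(θ) dθ + π`. -/
def lyapunovBound {A : Type*} (F : Config A → Config A) : ℝ :=
  (∫ θ in (0 : ℝ)..(2 * Real.pi), lyapunov F θ ^ 2 / 2) +
    Real.sqrt 2 * (∫ θ in (0 : ℝ)..Real.pi, lyapunov F θ) + Real.pi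

end CA2D

end

/-! Agreement on a half plane whose boundary lies at distance `Λ_m(θ)` from the origin determines
the first `m` iterates at the origin, up to a bounded error. Intersecting the half planes for the
four angles `0`, `π/2`, `π`, `3π/2` shows that `F^k x` at the origin, for `k ≤ m`, depends only on
the coordinates of `x` in a rectangle with sides `m w + o(m)` and `m v + o(m)`, where
`w = λ(0) + λ(π)` and `v = λ(π/2) + λ(3π/2)`. Hence `⋁_{k < m} F^{-k} α_n` is coarser than the
partition by the coordinates in a rectangle with sides about `n + m w` and `n + m v`, and covering
that rectangle by squares gives `h(F, α_n) ≤ (n + m w) (n + m v) / m · h(σ₁, σ₂, α_*)` up to lower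
order terms. Taking `n = c m` and then `c ↓ w` bounds `h^{2D}(F)` by `2 (w + v) h(σ₁, σ₂, α_*)`.

Intersecting instead the half planes for the angles `φ + t` and `φ - t` yields
`2 cos t · λ(φ) ≤ λ(φ + t) + λ(φ - t)`. Integrating over `|t| ≤ π/4` around the four angles gives
`√2 (w + v) ≤ ∫_0^{2π} λ`, and `√2 λ ≤ λ²/2 + 1` on `[π, 2π]` turns this into the stated bound. -/

namespace CA2D

section PartitionEntropy

theorem negMulLog_sum_le {κ : Type*} (s : Finset κ) {p : κ → ℝ} (hp : ∀ c ∈ s, 0 ≤ p c) :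
    Real.negMulLog (∑ c ∈ s, p c) ≤ ∑ c ∈ s, Real.negMulLog (p c) := by
  simp only [Real.negMulLog, neg_mul, Finset.sum_neg_distrib, neg_le_neg_iff, Finset.sum_mul]
  refine Finset.sum_le_sum fun c hc => ?_
  rcases (hp c hc).eq_or_lt with h | h
  · simp [← h]
  · have := Finset.single_le_sum hp hc
    gcongr

variable {ι κ : Type*} [Fintype ι] [Fintype κ]

theorem sum_negMulLog_le_add_marginals {P : ι → κ → ℝ} (hP : ∀ b c, 0 ≤ P b c)
    (hsum : ∑ b, ∑ c, P b c = 1) :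
    ∑ b, ∑ c, Real.negMulLog (P b c) ≤
      ∑ b, Real.negMulLog (∑ c, P b c) + ∑ c, Real.negMulLog (∑ b, P b c) := by
  set p : ι → ℝ := fun b => ∑ c, P b c
  have hp : ∀ b, 0 ≤ p b := fun b => Finset.sum_nonneg fun c _ => hP b c
  have mul_cond : ∀ b c, p b * (P b c / p b) = P b c := fun b c =>
    mul_div_cancel_of_imp' fun h => (Finset.sum_eq_zero_iff_of_nonneg fun c _ => hP b c).1 h c
      (Finset.mem_univ c)
  have chain_rule : ∀ b, ∑ c, Real.negMulLog (P b c) =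
      Real.negMulLog (p b) + ∑ c, p b * Real.negMulLog (P b c / p b) := fun b => by
    have hcond : (∑ c, P b c / p b) * Real.negMulLog (p b) = Real.negMulLog (p b) := by
      rw [← Finset.sum_div]
      rcases eq_or_ne (p b) 0 with h | h
      · simp [h]
      · rw [div_self h, one_mul]
    rw [← hcond, Finset.sum_mul, ← Finset.sum_add_distrib]
    exact Finset.sum_congr rfl fun c _ => by rw [← Real.negMulLog_mul, mul_cond]
  have jensen : ∀ c, ∑ b, p b * Real.negMulLog (P b c / p b) ≤
      Real.negMulLog (∑ b, P b c) := fun c => by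
    simpa only [smul_eq_mul, mul_cond] using Real.concaveOn_negMulLog.le_map_sum
      (fun b _ => hp b) hsum fun b _ => Set.mem_Ici.2 (div_nonneg (hP b c) (hp b))
  simp only [chain_rule, Finset.sum_add_distrib]
  rw [Finset.sum_comm (f := fun b c => p b * Real.negMulLog (P b c / p b))]
  gcongr with c
  exact jensen c

variable {X : Type*} [MeasurableSpace X] {μ : Measure X}

theorem partitionEntropy_comp [MeasurableSpace ι] [MeasurableSingletonClass ι] {f : X → ι}
    (hf : Measurable f) {T : X → X} (hT : MeasurePreserving T μ μ) :
    partitionEntropy μ (f ∘ T) = partitionEntropy μ f :=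
  Finset.sum_congr rfl fun b _ => by
    rw [Set.preimage_comp,
      hT.measureReal_preimage (hf (measurableSet_singleton b)).nullMeasurableSet]

theorem sum_measureReal_inter_preimage_singleton [IsFiniteMeasure μ] [MeasurableSpace κ]
    [MeasurableSingletonClass κ] {g : X → κ} (hg : Measurable g) (s : Set X) :
    ∑ c, μ.real (s ∩ g ⁻¹' {c}) = μ.real s := by
  have hfiber : ∀ c, MeasurableSet (g ⁻¹' {c}) := fun c => hg (measurableSet_singleton c)
  have h := sum_measureReal_preimage_singleton (μ := μ.restrict s) Finset.univ fun c _ => hfiber c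
  simpa [measureReal_restrict_apply (hfiber _), Set.inter_comm] using h

variable [IsProbabilityMeasure μ]

theorem partitionEntropy_nonneg (f : X → ι) : 0 ≤ partitionEntropy μ f :=
  Finset.sum_nonneg fun _ _ => Real.negMulLog_nonneg measureReal_nonneg measureReal_le_one

variable [MeasurableSpace κ] [MeasurableSingletonClass κ]

theorem partitionEntropy_le_of_factorsThrough {f : X → ι} {g : X → κ} (hg : Measurable g)
    (h : f.FactorsThrough g) : partitionEntropy μ f ≤ partitionEntropy μ g := by
  classical
  have : Nonempty ι := (nonempty_of_isProbabilityMeasure μ).map f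
  obtain ⟨e, rfl⟩ := (Function.factorsThrough_iff f).1 h
  have fiber : ∀ b, μ.real (e ∘ g ⁻¹' {b}) = ∑ c with e c = b, μ.real (g ⁻¹' {c}) := fun b => by
    rw [sum_measureReal_preimage_singleton _ fun c _ => hg (measurableSet_singleton c)]
    congr 1
    ext x
    simp
  calc ∑ b, Real.negMulLog (μ.real (e ∘ g ⁻¹' {b}))
      ≤ ∑ b, ∑ c with e c = b, Real.negMulLog (μ.real (g ⁻¹' {c})) := by
        gcongr with b
        rw [fiber]
        exact negMulLog_sum_le _ fun _ _ => measureReal_nonneg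
    _ = partitionEntropy μ g := Finset.sum_fiberwise _ _ _

variable [MeasurableSpace ι] [MeasurableSingletonClass ι]

theorem partitionEntropy_prodMk_le {f : X → ι} {g : X → κ} (hf : Measurable f)
    (hg : Measurable g) :
    partitionEntropy μ (fun x => (f x, g x)) ≤ partitionEntropy μ f + partitionEntropy μ g := by
  have left : ∀ b, ∑ c, μ.real (f ⁻¹' {b} ∩ g ⁻¹' {c}) = μ.real (f ⁻¹' {b}) := fun b =>
    sum_measureReal_inter_preimage_singleton hg _
  have right : ∀ c, ∑ b, μ.real (f ⁻¹' {b} ∩ g ⁻¹' {c}) = μ.real (g ⁻¹' {c}) := fun c => by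
    simpa only [Set.inter_comm] using
      sum_measureReal_inter_preimage_singleton (μ := μ) hf (g ⁻¹' {c})
  have total : ∑ b, ∑ c, μ.real (f ⁻¹' {b} ∩ g ⁻¹' {c}) = 1 := by
    simp only [left]
    simpa using sum_measureReal_inter_preimage_singleton (μ := μ) hf Set.univ
  have h := sum_negMulLog_le_add_marginals
    (fun b c => measureReal_nonneg (μ := μ) (s := f ⁻¹' {b} ∩ g ⁻¹' {c})) total
  simp only [left, right] at h
  simpa only [partitionEntropy, Fintype.sum_prod_type, ← Set.singleton_prod_singleton,
    Set.mk_preimage_prod] using h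

end PartitionEntropy

section JointEntropy

variable {X ι κ S : Type*} [MeasurableSpace X] [Fintype ι] [Fintype κ] [DecidableEq S]

/-- The entropy of the join of the partitions `f i`, `i ∈ s`. -/
noncomputable def jointEntropy (μ : Measure X) (f : S → X → ι) (s : Finset S) : ℝ :=
  partitionEntropy μ fun x (i : s) => f i x

variable {μ : Measure X} [IsProbabilityMeasure μ] {f : S → X → ι}

theorem jointEntropy_nonneg (s : Finset S) : 0 ≤ jointEntropy μ f s :=
  partitionEntropy_nonneg _

theorem jointEntropy_empty : jointEntropy μ f ∅ = 0 := by
  have h : ∀ b, (fun x (i : (∅ : Finset S)) => f i x) ⁻¹' {b} = Set.univ := fun b => by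
    ext x
    simp [eq_iff_true_of_subsingleton]
  simp [jointEntropy, partitionEntropy, h]

variable [MeasurableSpace ι] [MeasurableSingletonClass ι]

theorem partitionEntropy_le_jointEntropy (hf : ∀ i, Measurable (f i)) {g : X → κ} {s : Finset S}
    (h : ∀ x y, (∀ i ∈ s, f i x = f i y) → g x = g y) :
    partitionEntropy μ g ≤ jointEntropy μ f s :=
  partitionEntropy_le_of_factorsThrough (measurable_pi_lambda _ fun i => hf i)
    fun x y hxy => h x y fun i hi => congrFun hxy ⟨i, hi⟩

theorem jointEntropy_le_jointEntropy {S' : Type*} [DecidableEq S'] {g : S' → X → κ}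
    (hf : ∀ i, Measurable (f i)) {s : Finset S} {t : Finset S'}
    (h : ∀ x y, (∀ i ∈ s, f i x = f i y) → ∀ j ∈ t, g j x = g j y) :
    jointEntropy μ g t ≤ jointEntropy μ f s :=
  partitionEntropy_le_jointEntropy hf fun x y hxy => funext fun j => h x y hxy j j.2

theorem jointEntropy_comp_of_injective [MeasurableSpace κ] [MeasurableSingletonClass κ]
    (hf : ∀ i, Measurable (f i)) {e : ι → κ} (he : e.Injective) (s : Finset S) :
    jointEntropy μ (fun i => e ∘ f i) s = jointEntropy μ f s :=
  le_antisymm (jointEntropy_le_jointEntropy hf fun _ _ hxy i hi => congrArg e (hxy i hi))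
    (jointEntropy_le_jointEntropy (fun i => (measurable_of_countable e).comp (hf i))
      fun _ _ hxy i hi => he (hxy i hi))

theorem jointEntropy_mono (hf : ∀ i, Measurable (f i)) {s t : Finset S} (hst : s ⊆ t) :
    jointEntropy μ f s ≤ jointEntropy μ f t :=
  jointEntropy_le_jointEntropy hf fun _ _ hxy i hi => hxy i (hst hi)

theorem jointEntropy_union_le (hf : ∀ i, Measurable (f i)) (s t : Finset S) :
    jointEntropy μ f (s ∪ t) ≤ jointEntropy μ f s + jointEntropy μ f t := by
  have hm : ∀ s : Finset S, Measurable fun x (i : s) => f i x := fun s =>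
    measurable_pi_lambda _ fun i => hf i
  refine (partitionEntropy_le_of_factorsThrough ((hm s).prodMk (hm t)) fun x y hxy => ?_).trans
    (partitionEntropy_prodMk_le (hm s) (hm t))
  obtain ⟨hs, ht⟩ := Prod.mk.inj hxy
  funext ⟨i, hi⟩
  exact (Finset.mem_union.1 hi).elim (fun h => congrFun hs ⟨i, h⟩) fun h => congrFun ht ⟨i, h⟩

theorem jointEntropy_biUnion_le {J : Type*} (hf : ∀ i, Measurable (f i))
    (t : Finset J) (s : J → Finset S) :
    jointEntropy μ f (t.biUnion s) ≤ ∑ j ∈ t, jointEntropy μ f (s j) := by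
  classical
  induction t using Finset.induction_on with
  | empty => simp [jointEntropy_empty]
  | insert j t hj ih =>
    rw [Finset.biUnion_insert, Finset.sum_insert hj]
    exact (jointEntropy_union_le hf _ _).trans (by gcongr)

theorem jointEntropy_map (hf : ∀ i, Measurable (f i)) {T : X → X} (hT : MeasurePreserving T μ μ)
    {e : S ↪ S} (he : ∀ i, f (e i) = f i ∘ T) (s : Finset S) :
    jointEntropy μ f (s.map e) = jointEntropy μ f s := by
  have hfT : ∀ i, Measurable (f i ∘ T) := fun i => (hf i).comp hT.measurable
  have hcomp : jointEntropy μ (fun i => f i ∘ T) s = jointEntropy μ f s :=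
    partitionEntropy_comp (f := fun x (i : s) => f i x) (measurable_pi_lambda _ fun i => hf i) hT
  rw [← hcomp]
  refine le_antisymm (jointEntropy_le_jointEntropy hfT fun x y hxy => ?_)
    (jointEntropy_le_jointEntropy hf fun x y hxy => ?_)
  · simpa only [Finset.forall_mem_map, he] using hxy
  · simpa only [Finset.forall_mem_map, he] using hxy

end JointEntropy

section IterateEntropy

variable {X ι : Type*} [MeasurableSpace X] [Fintype ι] {μ : Measure X} [IsProbabilityMeasure μ]
  {T : X → X} {f : X → ι}

theorem bddBelow_range_entropySeq : BddBelow (Set.range (entropySeq μ T f)) :=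
  ⟨0, Set.forall_mem_range.2 fun m => div_nonneg (partitionEntropy_nonneg _) m.cast_nonneg⟩

variable [MeasurableSpace ι] [MeasurableSingletonClass ι]

theorem entropySeq_eq_jointEntropy_div (hT : Measurable T) (hf : Measurable f) :
    entropySeq μ T f = fun m => jointEntropy μ (fun k => f ∘ T^[k]) (Finset.range m) / m := by
  have hfT : ∀ k, Measurable (f ∘ T^[k]) := fun k => hf.comp (hT.iterate k)
  funext m
  refine congrArg (· / (m : ℝ)) (le_antisymm ?_ ?_)
  · exact partitionEntropy_le_jointEntropy hfT fun x y hxy =>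
      funext fun k => hxy k (Finset.mem_range.2 k.2)
  · exact partitionEntropy_le_of_factorsThrough
      (measurable_pi_lambda _ fun k : Fin m => hfT k)
      fun x y hxy => funext fun k => congrFun hxy ⟨k, Finset.mem_range.1 k.2⟩

theorem subadditive_jointEntropy_iterate (hT : MeasurePreserving T μ μ) (hf : Measurable f) :
    Subadditive fun m => jointEntropy μ (fun k => f ∘ T^[k]) (Finset.range m) := by
  intro m n
  have hfT : ∀ k, Measurable (f ∘ T^[k]) := fun k => hf.comp (hT.measurable.iterate k)
  have hshift : ∀ k, f ∘ T^[addLeftEmbedding m k] = (f ∘ T^[k]) ∘ T^[m] := fun k => by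
    rw [addLeftEmbedding_apply, add_comm, Function.iterate_add, Function.comp_assoc]
  have hmap := jointEntropy_map hfT (hT.iterate m) hshift (Finset.range n)
  have hunion := jointEntropy_union_le (μ := μ) hfT (Finset.range m)
    ((Finset.range n).map (addLeftEmbedding m))
  rwa [← Finset.range_add_eq_union, hmap] at hunion

theorem tendsto_entropySeq (hT : MeasurePreserving T μ μ) (hf : Measurable f) :
    Tendsto (entropySeq μ T f) atTop (𝓝 (entropyOf μ T f)) := by
  have hbdd := bddBelow_range_entropySeq (μ := μ) (T := T) (f := f)
  rw [entropySeq_eq_jointEntropy_div hT.measurable hf] at hbdd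
  have hsub := subadditive_jointEntropy_iterate hT hf
  refine tendsto_nhds_limUnder ⟨hsub.lim, ?_⟩
  rw [entropySeq_eq_jointEntropy_div hT.measurable hf]
  exact hsub.tendsto_lim hbdd

theorem entropyOf_le_entropySeq (hT : MeasurePreserving T μ μ) (hf : Measurable f) {m : ℕ}
    (hm : m ≠ 0) : entropyOf μ T f ≤ entropySeq μ T f m := by
  have hsub := subadditive_jointEntropy_iterate hT hf
  have hbdd := bddBelow_range_entropySeq (μ := μ) (T := T) (f := f)
  have hlim := tendsto_entropySeq hT hf
  rw [entropySeq_eq_jointEntropy_div hT.measurable hf] at hbdd hlim ⊢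
  exact (tendsto_nhds_unique hlim (hsub.tendsto_lim hbdd)).trans_le (hsub.lim_le_div hbdd hm)

end IterateEntropy

section Translate

variable {A : Type*}

/-- The translation action of `ℤ²` on configurations, of which the two shifts are the
generators. -/
def translate (v : ℤ × ℤ) (x : Config A) : Config A := fun p => x (p + v)

theorem translate_apply_zero (v : ℤ × ℤ) (x : Config A) : translate v x 0 = x v :=
  congrArg x (zero_add v)

theorem translate_zero : translate (0 : ℤ × ℤ) = (id : Config A → Config A) :=
  funext fun x => funext fun p => congrArg x (add_zero p)

theorem translate_add (v w : ℤ × ℤ) :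
    translate (A := A) (v + w) = translate v ∘ translate w :=
  funext fun x => funext fun p => congrArg x (add_assoc p v w).symm

theorem iterate_translate (v : ℤ × ℤ) (n : ℕ) : (translate (A := A) v)^[n] = translate (n • v) := by
  induction n with
  | zero => rw [Function.iterate_zero, zero_smul, translate_zero]
  | succ n ih => rw [Function.iterate_succ', ih, ← translate_add, succ_nsmul']

theorem shift₁_eq_translate : shift₁ (A := A) = translate (1, 0) :=
  funext fun x => funext fun p => congrArg x (by simp [Prod.ext_iff])

theorem shift₂_eq_translate : shift₂ (A := A) = translate (0, 1) :=
  funext fun x => funext fun p => congrArg x (by simp [Prod.ext_iff])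

theorem iterate_shift₁_iterate_shift₂ (i j : ℕ) (x : Config A) :
    shift₁^[i] (shift₂^[j] x) = translate ((i : ℤ), (j : ℤ)) x := by
  rw [shift₁_eq_translate, shift₂_eq_translate, iterate_translate, iterate_translate,
    ← Function.comp_apply (f := translate _), ← translate_add]
  simp

theorem mem_of_standard_basis_mem {G : AddSubgroup (ℤ × ℤ)} (h₁ : (1, 0) ∈ G) (h₂ : (0, 1) ∈ G)
    (v : ℤ × ℤ) : v ∈ G := by
  have hv : v = v.1 • (1, 0) + v.2 • (0, 1) := by simp
  exact hv ▸ add_mem (zsmul_mem h₁ v.1) (zsmul_mem h₂ v.2)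

variable [MeasurableSpace A]

theorem measurable_translate (v : ℤ × ℤ) : Measurable (translate (A := A) v) :=
  measurable_pi_lambda _ fun p => measurable_pi_apply (p + v)

theorem measurePreserving_translate {μ : Measure (Config A)} (h₁ : MeasurePreserving shift₁ μ μ)
    (h₂ : MeasurePreserving shift₂ μ μ) (v : ℤ × ℤ) : MeasurePreserving (translate v) μ μ := by
  let stabilizer : AddSubgroup (ℤ × ℤ) :=
    { carrier := {v | MeasurePreserving (translate v) μ μ}
      add_mem' := fun {v w} hv hw => by
        rw [Set.mem_ofPred_eq, translate_add]
        exact hv.comp hw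
      zero_mem' := by
        rw [Set.mem_ofPred_eq, translate_zero]
        exact MeasurePreserving.id μ
      neg_mem' := fun {v} hv => ⟨measurable_translate _, by
        conv_lhs => rw [← hv.map_eq]
        rw [Measure.map_map (measurable_translate _) (measurable_translate _), ← translate_add,
          neg_add_cancel, translate_zero, Measure.map_id]⟩ }
  have mem₁ : (1, 0) ∈ stabilizer := (congrArg (MeasurePreserving · μ μ) shift₁_eq_translate).mp h₁
  have mem₂ : (0, 1) ∈ stabilizer := (congrArg (MeasurePreserving · μ μ) shift₂_eq_translate).mp h₂
  exact mem_of_standard_basis_mem mem₁ mem₂ v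

end Translate

section WindowEntropy

/-- The rectangle of `a × b` lattice points whose lower left corner is `p`. -/
noncomputable def rect (p : ℤ × ℤ) (a b : ℕ) : Finset (ℤ × ℤ) :=
  Finset.Ico p.1 (p.1 + a) ×ˢ Finset.Ico p.2 (p.2 + b)

theorem mem_rect {p q : ℤ × ℤ} {a b : ℕ} :
    q ∈ rect p a b ↔ (p.1 ≤ q.1 ∧ q.1 < p.1 + a) ∧ p.2 ≤ q.2 ∧ q.2 < p.2 + b := by
  simp only [rect, Finset.mem_product, Finset.mem_Ico]

theorem map_addLeftEmbedding_rect (v p : ℤ × ℤ) (a b : ℕ) :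
    (rect p a b).map (addLeftEmbedding v) = rect (v + p) a b := by
  ext q
  simp only [Finset.mem_map, mem_rect, addLeftEmbedding_apply, Prod.fst_add, Prod.snd_add]
  refine ⟨?_, fun h => ⟨q - v, ?_, add_sub_cancel v q⟩⟩
  · rintro ⟨r, h, rfl⟩
    simp only [Prod.fst_add, Prod.snd_add]
    omega
  · simp only [Prod.fst_sub, Prod.snd_sub]
    omega

theorem rect_subset_biUnion (p : ℤ × ℤ) (a b : ℕ) {k : ℕ} (hk : 0 < k) :
    rect p a b ⊆ (Finset.range (a / k + 1) ×ˢ Finset.range (b / k + 1)).biUnion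
      fun ij => rect (p + (((k * ij.1 : ℕ) : ℤ), ((k * ij.2 : ℕ) : ℤ))) k k := by
  intro q hq
  obtain ⟨⟨hi, hi'⟩, hj, hj'⟩ := mem_rect.1 hq
  obtain ⟨i, hi⟩ := Int.le.dest hi
  obtain ⟨j, hj⟩ := Int.le.dest hj
  have hia : i / k ≤ a / k := Nat.div_le_div_right (by omega)
  have hjb : j / k ≤ b / k := Nat.div_le_div_right (by omega)
  have hik := Nat.div_add_mod i k
  have hjk := Nat.div_add_mod j k
  have hik' := Nat.mod_lt i hk
  have hjk' := Nat.mod_lt j hk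
  refine Finset.mem_biUnion.2 ⟨(i / k, j / k), ?_, mem_rect.2 ?_⟩
  · simp only [Finset.mem_product, Finset.mem_range]
    omega
  · simp only [Prod.fst_add, Prod.snd_add]
    omega

variable {A ι : Type*} [MeasurableSpace A] [Fintype ι]

/-- The entropy of the join of the translates of the partition `f` by the vectors of the finite
window `s`. -/
noncomputable def windowEntropy (μ : Measure (Config A)) (f : Config A → ι)
    (s : Finset (ℤ × ℤ)) : ℝ :=
  jointEntropy μ (fun q => f ∘ translate q) s

variable [MeasurableSpace ι] [MeasurableSingletonClass ι] {μ : Measure (Config A)}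
  [IsProbabilityMeasure μ] {f : Config A → ι}

theorem shiftEntropySeq_eq_windowEntropy_div (hf : Measurable f) (n : ℕ) :
    shiftEntropySeq μ f n = windowEntropy μ f (rect 0 n n) / (n : ℝ) ^ 2 := by
  have hft : ∀ q, Measurable (f ∘ translate q) := fun q =>
    hf.comp (measurable_translate q)
  simp only [shiftEntropySeq, iterate_shift₁_iterate_shift₂]
  refine congrArg (· / (n : ℝ) ^ 2) (le_antisymm ?_ ?_)
  · refine partitionEntropy_le_jointEntropy hft fun x y hxy => funext fun q => hxy _ ?_
    simp [mem_rect]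
  · refine partitionEntropy_le_of_factorsThrough (measurable_pi_lambda _ fun q => hft _)
      fun x y hxy => funext fun ⟨q, hq⟩ => ?_
    obtain ⟨⟨hi, hi'⟩, hj, hj'⟩ := mem_rect.1 hq
    lift q to ℕ × ℕ using ⟨hi, hj⟩
    exact congrFun hxy (⟨q.1, by simpa using hi'⟩, ⟨q.2, by simpa using hj'⟩)

theorem windowEntropy_rect (h₁ : MeasurePreserving shift₁ μ μ) (h₂ : MeasurePreserving shift₂ μ μ)
    (hf : Measurable f) (p : ℤ × ℤ) (a b : ℕ) :
    windowEntropy μ f (rect p a b) = windowEntropy μ f (rect 0 a b) := by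
  have h := jointEntropy_map (fun q => hf.comp (measurable_translate q))
    (measurePreserving_translate h₁ h₂ p) (e := addLeftEmbedding p)
    (fun q => by rw [addLeftEmbedding_apply, add_comm, translate_add, Function.comp_assoc])
    (rect 0 a b)
  rwa [map_addLeftEmbedding_rect, add_zero] at h

theorem windowEntropy_rect_le (h₁ : MeasurePreserving shift₁ μ μ)
    (h₂ : MeasurePreserving shift₂ μ μ) (hf : Measurable f) (p : ℤ × ℤ) (a b : ℕ) {k : ℕ}
    (hk : 0 < k) :
    windowEntropy μ f (rect p a b) ≤ ((a + k : ℝ) * (b + k)) * shiftEntropySeq μ f k := by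
  have hft : ∀ q, Measurable (f ∘ translate q) := fun q =>
    hf.comp (measurable_translate q)
  have cover : windowEntropy μ f (rect p a b) ≤
      ((a / k + 1 : ℕ) * (b / k + 1 : ℕ) : ℝ) * windowEntropy μ f (rect 0 k k) := by
    refine (jointEntropy_mono hft (rect_subset_biUnion p a b hk)).trans
      ((jointEntropy_biUnion_le hft _ _).trans_eq ?_)
    refine (Finset.sum_congr rfl fun _ _ => windowEntropy_rect h₁ h₂ hf _ k k).trans ?_
    rw [Finset.sum_const, Finset.card_product, Finset.card_range, Finset.card_range, nsmul_eq_mul,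
      Nat.cast_mul]
  have count : ∀ c : ℕ, ((c / k + 1 : ℕ) : ℝ) ≤ (c + k) / k := fun c => by
    rw [add_div, div_self (by positivity), Nat.cast_succ]
    gcongr
    exact Nat.cast_div_le
  calc windowEntropy μ f (rect p a b)
      ≤ ((a + k : ℝ) / k * ((b + k) / k)) * windowEntropy μ f (rect 0 k k) := by
        refine cover.trans (mul_le_mul_of_nonneg_right ?_ (jointEntropy_nonneg _))
        gcongr <;> exact count _
    _ = ((a + k : ℝ) * (b + k)) * shiftEntropySeq μ f k := by
        rw [shiftEntropySeq_eq_windowEntropy_div hf]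
        ring

end WindowEntropy

section ShiftEntropy

theorem exists_tendsto_of_le_mul {u : ℕ → ℝ} {c : ℕ → ℕ → ℝ} (hu : BddBelow (Set.range u))
    (hc : ∀ k, Tendsto (c k) atTop (𝓝 1)) (h : ∀ k n, 0 < k → 0 < n → u n ≤ c k n * u k) :
    ∃ l, Tendsto u atTop (𝓝 l) := by
  have hu' : BddBelow (u '' Set.Ioi 0) := hu.mono (Set.image_subset_range _ _)
  refine ⟨sInf (u '' Set.Ioi 0), tendsto_order.2 ⟨fun a ha => ?_, fun a ha => ?_⟩⟩
  · filter_upwards [eventually_gt_atTop 0] with n hn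
    exact ha.trans_le (csInf_le hu' ⟨n, hn, rfl⟩)
  · obtain ⟨_, ⟨k, hk, rfl⟩, hka⟩ := exists_lt_of_csInf_lt (Set.nonempty_Ioi.image u) ha
    have hlim : Tendsto (fun n => c k n * u k) atTop (𝓝 (u k)) := by
      simpa using (hc k).mul_const (u k)
    filter_upwards [eventually_gt_atTop 0, hlim.eventually_lt_const hka] with n hn hlt
    exact (h k n hk hn).trans_lt hlt

variable {A ι : Type*} [MeasurableSpace A] [Fintype ι] {μ : Measure (Config A)}
  [IsProbabilityMeasure μ]

theorem shiftEntropySeq_nonneg (f : Config A → ι) (n : ℕ) : 0 ≤ shiftEntropySeq μ f n :=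
  div_nonneg (partitionEntropy_nonneg _) (sq_nonneg _)

variable [MeasurableSpace ι] [MeasurableSingletonClass ι] {f : Config A → ι}

theorem tendsto_shiftEntropySeq (h₁ : MeasurePreserving shift₁ μ μ)
    (h₂ : MeasurePreserving shift₂ μ μ) (hf : Measurable f) :
    Tendsto (shiftEntropySeq μ f) atTop (𝓝 (shiftEntropyOf μ f)) := by
  refine tendsto_nhds_limUnder (exists_tendsto_of_le_mul (c := fun k n => (1 + k / n : ℝ) ^ 2)
    ⟨0, Set.forall_mem_range.2 (shiftEntropySeq_nonneg f)⟩ (fun k => ?_) fun k n hk hn => ?_)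
  · simpa using ((tendsto_const_div_atTop_nhds_zero_nat (k : ℝ)).const_add 1).pow 2
  · rw [shiftEntropySeq_eq_windowEntropy_div hf, div_le_iff₀ (by positivity)]
    refine (windowEntropy_rect_le h₁ h₂ hf 0 n n hk).trans_eq ?_
    field_simp

theorem shiftEntropyOf_nonneg (h₁ : MeasurePreserving shift₁ μ μ)
    (h₂ : MeasurePreserving shift₂ μ μ) (hf : Measurable f) : 0 ≤ shiftEntropyOf μ f :=
  ge_of_tendsto' (tendsto_shiftEntropySeq h₁ h₂ hf) (shiftEntropySeq_nonneg f)

theorem measurable_centralPartition : Measurable (centralPartition (A := A)) :=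
  measurable_pi_apply _

theorem measurable_squarePartition (n : ℕ) : Measurable (squarePartition (A := A) n) :=
  measurable_pi_lambda _ fun _ => measurable_pi_apply _

theorem shiftEntropyOf_le_shiftEntropy (hf : Measurable f) :
    ((shiftEntropyOf μ f : ℝ) : EReal) ≤ shiftEntropy μ := by
  let e := Fintype.equivFin ι
  have hef : Measurable (e ∘ f) := (measurable_of_countable e).comp hf
  have hseq : shiftEntropySeq μ f = shiftEntropySeq μ (e ∘ f) := funext fun n => by
    rw [shiftEntropySeq_eq_windowEntropy_div hf, shiftEntropySeq_eq_windowEntropy_div hef,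
      windowEntropy,
      ← jointEntropy_comp_of_injective (fun q => hf.comp (measurable_translate q)) e.injective]
    rfl
  rw [shiftEntropyOf, hseq]
  exact le_iSup₂ (f := fun m (f : {f : Config A → Fin m // Measurable f}) =>
    ((shiftEntropyOf μ f.1 : ℝ) : EReal)) _ ⟨e ∘ f, hef⟩

end ShiftEntropy

section DependsOn

theorem dependsOn_inter {ι β : Type*} {α : ι → Type*} {f : (∀ i, α i) → β} {s t : Set ι}
    (hs : DependsOn f s) (ht : DependsOn f t) : DependsOn f (s ∩ t) := by
  classical
  intro x y h
  have eq_left : f x = f (s.piecewise x y) := hs fun i hi => (s.piecewise_eq_of_mem x y hi).symm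
  have eq_right : f (s.piecewise x y) = f y := ht fun i hit => by
    by_cases his : i ∈ s
    · rw [s.piecewise_eq_of_mem x y his, h i ⟨his, hit⟩]
    · rw [s.piecewise_eq_of_notMem x y his]
  exact eq_left.trans eq_right

theorem exists_finset_dependsOn_of_continuous {ι A B : Type*} [Finite A] [TopologicalSpace A]
    [DiscreteTopology A] [TopologicalSpace B] [DiscreteTopology B] {f : (ι → A) → B}
    (hf : Continuous f) : ∃ s : Finset ι, DependsOn f (s : Set ι) := by
  classical
  have locally_determined : ∀ x, ∃ s : Finset ι, ∀ y, (∀ i ∈ s, y i = x i) → f y = f x := by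
    intro x
    have hx : f ⁻¹' {f x} ∈ 𝓝 x := hf.continuousAt.preimage_mem_nhds (by simp)
    rw [nhds_pi, Filter.mem_pi'] at hx
    obtain ⟨s, t, ht, hst⟩ := hx
    exact ⟨s, fun y hy => hst fun i hi => (hy i hi).symm ▸ mem_of_mem_nhds (ht i)⟩
  choose s hs using locally_determined
  have cylinder_mem_nhds : ∀ x : ι → A, {y | ∀ i ∈ s x, y i = x i} ∈ 𝓝 x := fun x =>
    (Filter.eventually_all_finset (s x)).2 fun i _ =>
      (continuous_apply i).continuousAt.eventually_mem (by simp : {x i} ∈ 𝓝 (x i))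
  obtain ⟨t, -, ht⟩ := isCompact_univ.elim_nhds_subcover _ fun x _ => cylinder_mem_nhds x
  refine ⟨t.biUnion s, fun y z hyz => ?_⟩
  obtain ⟨x, hxt, hyx⟩ := Set.mem_iUnion₂.1 (ht (Set.mem_univ y))
  have hzx : ∀ i ∈ s x, z i = x i := fun i hi =>
    (hyz i (Finset.mem_biUnion.2 ⟨x, hxt, hi⟩)).symm.trans (hyx i hi)
  rw [hs x y hyx, hs x z hzx]

end DependsOn

section HalfPlane

/-- The signed height of the lattice point `p` in direction `θ`, that is, the scalar product of `p`
with `(cos θ, sin θ)`. -/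
noncomputable def level (θ : ℝ) (p : ℤ × ℤ) : ℝ := p.1 * Real.cos θ + p.2 * Real.sin θ

/-- The Euclidean length of a lattice vector. -/
noncomputable def len (p : ℤ × ℤ) : ℝ := Real.sqrt ((p.1 : ℝ) ^ 2 + (p.2 : ℝ) ^ 2)

/-- The inclusion of the lattice in the complex plane. -/
noncomputable def toComplex : ℤ × ℤ →+ ℂ where
  toFun p := ⟨p.1, p.2⟩
  map_zero' := by simp [Complex.ext_iff]
  map_add' p q := by simp [Complex.ext_iff]

theorem level_eq_inner (θ : ℝ) (p : ℤ × ℤ) :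
    level θ p = inner ℝ (Complex.exp (θ * Complex.I)) (toComplex p) := by
  simp [level, toComplex, Complex.inner, Complex.exp_ofReal_mul_I_re, Complex.exp_ofReal_mul_I_im]

theorem len_eq_norm (p : ℤ × ℤ) : len p = ‖toComplex p‖ := by
  rw [len, Complex.norm_eq_sqrt_sq_add_sq]
  rfl

theorem len_nonneg (p : ℤ × ℤ) : 0 ≤ len p := Real.sqrt_nonneg _

theorem len_add_le (p q : ℤ × ℤ) : len (p + q) ≤ len p + len q := by
  simpa only [len_eq_norm, map_add] using norm_add_le _ _

theorem norm_le_len (p : ℤ × ℤ) : ‖p‖ ≤ len p := by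
  rw [len_eq_norm, Prod.norm_def, max_le_iff]
  exact ⟨Complex.abs_re_le_norm (toComplex p), Complex.abs_im_le_norm (toComplex p)⟩

theorem tendsto_len_cofinite : Tendsto len cofinite atTop := by
  rw [← cocompact_eq_cofinite]
  exact tendsto_atTop_mono norm_le_len (tendsto_norm_cocompact_atTop (E := ℤ × ℤ))

theorem finite_setOf_len_le (c : ℝ) : {p : ℤ × ℤ | len p ≤ c}.Finite := by
  simpa only [eventually_cofinite, not_lt] using tendsto_len_cofinite.eventually_gt_atTop c

theorem level_add (θ : ℝ) (p q : ℤ × ℤ) : level θ (p + q) = level θ p + level θ q := by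
  simp only [level_eq_inner, map_add, inner_add_right]

theorem level_zero (θ : ℝ) : level θ 0 = 0 := by
  rw [level_eq_inner, map_zero, inner_zero_right]

theorem level_le_len (θ : ℝ) (p : ℤ × ℤ) : level θ p ≤ len p := by
  rw [level_eq_inner, len_eq_norm]
  simpa using real_inner_le_norm (Complex.exp (θ * Complex.I)) (toComplex p)

theorem level_le_level_add (θ η : ℝ) (p : ℤ × ℤ) :
    level θ p ≤ level η p + |θ - η| * len p := by
  rw [← sub_le_iff_le_add', level_eq_inner, level_eq_inner, ← inner_sub_left, len_eq_norm]
  refine (real_inner_le_norm _ _).trans (mul_le_mul_of_nonneg_right ?_ (norm_nonneg _))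
  have hexp : Complex.exp (θ * Complex.I) - Complex.exp (η * Complex.I) =
      Complex.exp (η * Complex.I) * (Complex.exp (Complex.I * (θ - η : ℝ)) - 1) := by
    rw [mul_sub_one, ← Complex.exp_add]
    push_cast
    ring_nf
  rw [hexp, norm_mul, Complex.norm_exp_ofReal_mul_I, one_mul]
  exact Real.norm_exp_I_mul_ofReal_sub_one_le

theorem exists_norm_toComplex_sub_le (z : ℂ) : ∃ p, ‖toComplex p - z‖ ≤ 1 := by
  refine ⟨(round z.re, round z.im), (Complex.norm_le_abs_re_add_abs_im _).trans ?_⟩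
  have hre := abs_sub_round z.re
  have him := abs_sub_round z.im
  rw [abs_sub_comm] at hre him
  exact (add_le_add hre him).trans_eq (add_halves 1)

theorem exists_le_level_len_le (θ : ℝ) {c : ℝ} (hc : 0 ≤ c) :
    ∃ p : ℤ × ℤ, c ≤ level θ p ∧ len p ≤ c + 2 := by
  set u := Complex.exp (θ * Complex.I)
  have hu : ‖u‖ = 1 := Complex.norm_exp_ofReal_mul_I θ
  obtain ⟨p, hp⟩ := exists_norm_toComplex_sub_le ((c + 1) • u)
  set d := toComplex p - (c + 1) • u with hd
  have hpd : toComplex p = (c + 1) • u + d := by rw [hd, add_sub_cancel]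
  refine ⟨p, ?_, ?_⟩
  · have hinner : inner ℝ u (toComplex p) = c + 1 + inner ℝ u d := by
      rw [hpd, inner_add_right, real_inner_smul_right, real_inner_self_eq_norm_sq, hu]
      ring
    have herr := neg_le_of_abs_le (abs_real_inner_le_norm u d)
    rw [hu, one_mul] at herr
    rw [level_eq_inner, hinner]
    linarith
  · calc len p ≤ ‖(c + 1) • u‖ + ‖d‖ := by
          rw [len_eq_norm, hpd]
          exact norm_add_le _ _
      _ ≤ (c + 1) + 1 := by
          rw [norm_smul, hu, mul_one, Real.norm_of_nonneg (by positivity)]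
          gcongr
      _ = c + 2 := by ring

theorem level_le_of_mem_halfPlane {θ : ℝ} {p q : ℤ × ℤ} (h : q ∈ halfPlane θ p) :
    level θ q ≤ level θ p + 2 := by
  obtain ⟨s, t, hst, rfl⟩ := h
  have fract_mul : ∀ r c : ℝ, |c| ≤ 1 → ⌊r⌋ * c ≤ r * c + 1 := fun r c hc => by
    rw [← Int.self_sub_fract]
    nlinarith [Int.fract_nonneg r, Int.fract_lt_one r, neg_le_of_abs_le hc]
  have hs := fract_mul s _ (Real.abs_cos_le_one θ)
  have ht := fract_mul t _ (Real.abs_sin_le_one θ)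
  simp only [level]
  linarith

theorem mem_halfPlane_of_level_le {θ : ℝ} {p q : ℤ × ℤ} (h : level θ q ≤ level θ p) :
    q ∈ halfPlane θ p :=
  ⟨q.1, q.2, h, by simp⟩

theorem halfPlane_subset_halfPlane {θ : ℝ} {p q : ℤ × ℤ} (h : level θ p ≤ level θ q) :
    halfPlane θ p ⊆ halfPlane θ q := by
  rintro _ ⟨s, t, hst, rfl⟩
  exact ⟨s, t, hst.trans h, rfl⟩

theorem add_mem_halfPlane {θ : ℝ} {p q : ℤ × ℤ} (h : q ∈ halfPlane θ p) (v : ℤ × ℤ) :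
    q + v ∈ halfPlane θ (p + v) := by
  obtain ⟨s, t, hst, rfl⟩ := h
  refine ⟨s + v.1, t + v.2, ?_, by simp [Prod.ext_iff]⟩
  simp only [Prod.fst_add, Prod.snd_add, Int.cast_add]
  linarith

end HalfPlane

section LocalRules

variable {A : Type*} {F : Config A → Config A}

theorem IsCellularAutomaton.commute_translate [TopologicalSpace A] (hF : IsCellularAutomaton F)
    (v : ℤ × ℤ) : Function.Commute F (translate v) := by
  let centralizer : AddSubgroup (ℤ × ℤ) :=
    { carrier := {v | Function.Commute F (translate v)}
      add_mem' := fun {v w} hv hw => by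
        rw [Set.mem_ofPred_eq, translate_add]
        exact hv.comp_right hw
      zero_mem' := by
        rw [Set.mem_ofPred_eq, translate_zero]
        exact Function.Commute.id_right
      neg_mem' := fun {v} hv => Function.Semiconj.inverses_right hv
        (Function.rightInverse_iff_comp.2 <| by
          rw [← translate_add, add_neg_cancel, translate_zero])
        (Function.leftInverse_iff_comp.2 <| by
          rw [← translate_add, neg_add_cancel, translate_zero]) }
  have mem₁ : (1, 0) ∈ centralizer :=
    (congrArg (Function.Commute F) shift₁_eq_translate).mp hF.comm₁
  have mem₂ : (0, 1) ∈ centralizer :=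
    (congrArg (Function.Commute F) shift₂_eq_translate).mp hF.comm₂
  exact mem_of_standard_basis_mem mem₁ mem₂ v

theorem IsCellularAutomaton.iterate_apply [TopologicalSpace A] (hF : IsCellularAutomaton F)
    (k : ℕ) (x : Config A) (v : ℤ × ℤ) : F^[k] x v = F^[k] (translate v x) 0 := by
  rw [(hF.commute_translate v).iterate_left k x, translate_apply_zero]

/-- The local rules of `id, F, …, F^n` read only the coordinates in `s`. -/
def LocalRulesDependOn (F : Config A → Config A) (n : ℕ) (s : Set (ℤ × ℤ)) : Prop :=
  ∀ k ≤ n, DependsOn (fun x => F^[k] x 0) s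

theorem LocalRulesDependOn.mono {n : ℕ} {s t : Set (ℤ × ℤ)} (h : LocalRulesDependOn F n s)
    (hst : s ⊆ t) : LocalRulesDependOn F n t :=
  fun k hk => (h k hk).mono hst

theorem LocalRulesDependOn.inter {n : ℕ} {s t : Set (ℤ × ℤ)} (hs : LocalRulesDependOn F n s)
    (ht : LocalRulesDependOn F n t) : LocalRulesDependOn F n (s ∩ t) :=
  fun k hk => dependsOn_inter (hs k hk) (ht k hk)

theorem LocalRulesDependOn.iterate_apply_eq [TopologicalSpace A] (hF : IsCellularAutomaton F)
    {n : ℕ} {s : Set (ℤ × ℤ)} (h : LocalRulesDependOn F n s) {k : ℕ} (hk : k ≤ n)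
    {x y : Config A} {v : ℤ × ℤ} (hxy : ∀ q ∈ s, x (q + v) = y (q + v)) :
    F^[k] x v = F^[k] y v := by
  rw [hF.iterate_apply k x v, hF.iterate_apply k y v]
  exact h k hk hxy

theorem exists_localRulesDependOn_len_le [Finite A] [TopologicalSpace A] [DiscreteTopology A]
    (hF : IsCellularAutomaton F) :
    ∃ R : ℝ, 0 ≤ R ∧ ∀ n : ℕ, LocalRulesDependOn F n {q | len q ≤ R * n} := by
  obtain ⟨s, hs⟩ := exists_finset_dependsOn_of_continuous
    ((continuous_apply (0 : ℤ × ℤ)).comp hF.continuous)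
  obtain ⟨r, hr⟩ := (s.finite_toSet.image len).bddAbove
  have radius : ∀ k : ℕ, DependsOn (fun x => F^[k] x 0) {q | len q ≤ max r 0 * k} := fun k => by
    induction k with
    | zero => exact fun x y h => h 0 (by simp [len])
    | succ k ih =>
      intro x y h
      simp only [Function.iterate_succ_apply]
      refine ih fun q hq => ?_
      have hq : len q ≤ max r 0 * k := hq
      have hFx : ∀ x, F x q = F (translate q x) 0 := fun x => hF.iterate_apply 1 x q
      rw [hFx, hFx]
      refine hs fun p hp => h (p + q) ?_
      have hp : len p ≤ max r 0 := (hr ⟨p, hp, rfl⟩).trans (le_max_left r 0)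
      rw [Set.mem_ofPred_eq, Nat.cast_succ, mul_add_one]
      linarith [len_add_le p q]
  refine ⟨max r 0, le_max_right r 0, fun n k hk => (radius k).mono fun q hq => hq.out.trans ?_⟩
  gcongr

end LocalRules

section Controls

variable {A : Type*} {F : Config A → Config A}

/-- The lattice point `p` is admissible in the definition of `Λ_n^F(θ)(x)`: agreement with `x` on
the half plane through `p`, which contains the origin, propagates under `F, …, F^n` to agreement on
the half plane through the origin. Here `k = 0` is allowed, since it imposes no condition. -/
def Controls (F : Config A → Config A) (n : ℕ) (θ : ℝ) (p : ℤ × ℤ) (x : Config A) : Prop :=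
  0 ≤ level θ p ∧ ∀ k ≤ n, ∀ y ∈ agreeSet θ p x, F^[k] y ∈ agreeSet θ 0 (F^[k] x)

theorem agreeSet_subset_agreeSet {θ : ℝ} {p q : ℤ × ℤ} (h : level θ p ≤ level θ q)
    (x : Config A) : agreeSet θ q x ⊆ agreeSet θ p x :=
  fun _ hy r hr => hy r (halfPlane_subset_halfPlane h hr)

theorem Controls.mono {n : ℕ} {θ : ℝ} {p q : ℤ × ℤ} {x : Config A} (h : Controls F n θ p x)
    (hpq : level θ p ≤ level θ q) : Controls F n θ q x :=
  ⟨h.1.trans hpq, fun k hk y hy => h.2 k hk y (agreeSet_subset_agreeSet hpq x hy)⟩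

theorem propagationRadii_eq_image_len (F : Config A → Config A) (n : ℕ) (θ : ℝ) (x : Config A) :
    propagationRadii F n θ x = len '' {p | Controls F n θ p x} := by
  ext s
  constructor
  · rintro ⟨p, hp, rfl, h⟩
    refine ⟨p, ⟨hp, fun k hk y hy => ?_⟩, rfl⟩
    rcases k.eq_zero_or_pos with rfl | hk0
    · exact agreeSet_subset_agreeSet (by rwa [level_zero]) x hy
    · exact h k hk0 hk ⟨y, hy, rfl⟩
  · rintro ⟨p, ⟨hp, h⟩, rfl⟩
    exact ⟨p, hp, rfl, fun k _ hk => Set.image_subset_iff.2 (h k hk)⟩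

theorem localRulesDependOn_of_controls {n : ℕ} {θ : ℝ} {p : ℤ × ℤ}
    (h : ∀ x, Controls F n θ p x) : LocalRulesDependOn F n {q | level θ q ≤ level θ p + 2} :=
  fun k hk x y hxy => (h y).2 k hk x (fun q hq => hxy q (level_le_of_mem_halfPlane hq)) 0
    (mem_halfPlane_of_level_le le_rfl)

variable [TopologicalSpace A]

theorem LocalRulesDependOn.controls (hF : IsCellularAutomaton F) {n : ℕ} {θ c : ℝ} {p : ℤ × ℤ}
    (h : LocalRulesDependOn F n {q | level θ q ≤ c}) (hp0 : 0 ≤ level θ p)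
    (hp : c + 2 ≤ level θ p) (x : Config A) : Controls F n θ p x := by
  refine ⟨hp0, fun k hk y hy v hv => h.iterate_apply_eq hF hk fun q hq =>
    hy _ (mem_halfPlane_of_level_le ?_)⟩
  have hq : level θ q ≤ c := hq
  have hv := level_le_of_mem_halfPlane hv
  rw [level_zero] at hv
  rw [level_add]
  linarith

theorem Controls.iterate_mem_agreeSet (hF : IsCellularAutomaton F) {n : ℕ} {θ : ℝ} {p q : ℤ × ℤ}
    {x y : Config A} (hq : Controls F n θ q (translate p x)) (hy : y ∈ agreeSet θ (q + p) x)
    {k : ℕ} (hk : k ≤ n) : F^[k] y ∈ agreeSet θ p (F^[k] x) := by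
  intro r hr
  have h := hq.2 k hk (translate p y) (fun s hs => hy (s + p) (add_mem_halfPlane hs p)) (r - p)
    (by simpa [sub_eq_add_neg] using add_mem_halfPlane hr (-p))
  rw [(hF.commute_translate p).iterate_left k, (hF.commute_translate p).iterate_left k] at h
  simpa only [translate, sub_add_cancel] using h

theorem Controls.add (hF : IsCellularAutomaton F) {m n : ℕ} {θ : ℝ} {p q : ℤ × ℤ}
    (hp : ∀ x, Controls F m θ p x) (hq : ∀ x, Controls F n θ q x) (x : Config A) :
    Controls F (m + n) θ (q + p) x := by
  refine ⟨by rw [level_add]; exact add_nonneg (hq x).1 (hp x).1, fun k hk y hy => ?_⟩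
  have hn : ∀ j ≤ n, F^[j] y ∈ agreeSet θ p (F^[j] x) := fun j =>
    (hq (translate p x)).iterate_mem_agreeSet hF hy
  rcases le_total k n with hkn | hkn
  · exact agreeSet_subset_agreeSet (by rw [level_zero]; exact (hp x).1) _ (hn k hkn)
  · obtain ⟨i, rfl⟩ := Nat.exists_eq_add_of_le' hkn
    rw [Function.iterate_add_apply, Function.iterate_add_apply]
    exact (hp (F^[n] x)).2 i (by omega) _ (hn n le_rfl)

end Controls

section Propagation

variable {A : Type*} [TopologicalSpace A] [DiscreteTopology A] [Finite A] {F : Config A → Config A}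

theorem exists_forall_controls (hF : IsCellularAutomaton F) (n : ℕ) (θ : ℝ) :
    ∃ p, ∀ x, Controls F n θ p x := by
  obtain ⟨R, hR, h⟩ := exists_localRulesDependOn_len_le hF
  obtain ⟨p, hp, -⟩ := exists_le_level_len_le θ (by positivity : 0 ≤ R * n + 2)
  have hlevel : LocalRulesDependOn F n {q | level θ q ≤ R * n} :=
    (h n).mono fun q hq => (level_le_len θ q).trans hq
  exact ⟨p, hlevel.controls hF (le_trans (by positivity) hp) hp⟩

theorem isLeast_propagationAt (hF : IsCellularAutomaton F) (n : ℕ) (θ : ℝ) (x : Config A) :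
    IsLeast (propagationRadii F n θ x) (propagationAt F n θ x) := by
  obtain ⟨p, hp, hmin⟩ := tendsto_len_cofinite.exists_within_forall_le
    (s := {p | Controls F n θ p x}) ((exists_forall_controls hF n θ).imp fun p hp => hp x)
  have hleast : IsLeast (propagationRadii F n θ x) (len p) := by
    rw [propagationRadii_eq_image_len]
    exact ⟨⟨p, hp, rfl⟩, Set.forall_mem_image.2 hmin⟩
  rwa [propagationAt, hleast.csInf_eq]

theorem propagationAt_le_len (hF : IsCellularAutomaton F) {n : ℕ} {θ : ℝ} {x : Config A}
    {p : ℤ × ℤ} (hp : Controls F n θ p x) : propagationAt F n θ x ≤ len p :=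
  (isLeast_propagationAt hF n θ x).2 (propagationRadii_eq_image_len F n θ x ▸ ⟨p, hp, rfl⟩)

theorem exists_controls_propagationAt (hF : IsCellularAutomaton F) (n : ℕ) (θ : ℝ)
    (x : Config A) : ∃ p, Controls F n θ p x ∧ len p = propagationAt F n θ x := by
  have h := (isLeast_propagationAt hF n θ x).1
  rwa [propagationRadii_eq_image_len] at h

variable [Nonempty A]

theorem isGreatest_propagation (hF : IsCellularAutomaton F) (n : ℕ) (θ : ℝ) :
    IsGreatest (Set.range (propagationAt F n θ)) (propagation F n θ) := by
  obtain ⟨p₀, hp₀⟩ := exists_forall_controls hF n θ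
  have hfin : (Set.range (propagationAt F n θ)).Finite := by
    refine ((finite_setOf_len_le (len p₀)).image len).subset (Set.range_subset_iff.2 fun x => ?_)
    obtain ⟨p, -, hp⟩ := exists_controls_propagationAt hF n θ x
    exact ⟨p, hp.trans_le (propagationAt_le_len hF (hp₀ x)), hp⟩
  exact ⟨(Set.range_nonempty _).csSup_mem hfin, fun s hs => le_csSup hfin.bddAbove hs⟩

theorem propagation_le_len (hF : IsCellularAutomaton F) {n : ℕ} {θ : ℝ} {p : ℤ × ℤ}
    (hp : ∀ x, Controls F n θ p x) : propagation F n θ ≤ len p := by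
  obtain ⟨x, hx⟩ := (isGreatest_propagation hF n θ).1
  exact hx ▸ propagationAt_le_len hF (hp x)

/-- The admissible points that realise `Λ_n^F(θ)(x)` depend on `x`; among the finitely many lattice
points of length at most `Λ_n^F(θ)`, one that maximises the level is admissible for every `x`. -/
theorem exists_forall_controls_propagation (hF : IsCellularAutomaton F) (n : ℕ) (θ : ℝ) :
    ∃ p, (∀ x, Controls F n θ p x) ∧ len p = propagation F n θ := by
  have hle : ∀ x, ∃ q, Controls F n θ q x ∧ len q ≤ propagation F n θ := fun x => by
    obtain ⟨q, hq, hq'⟩ := exists_controls_propagationAt hF n θ x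
    exact ⟨q, hq, hq'.trans_le ((isGreatest_propagation hF n θ).2 ⟨x, rfl⟩)⟩
  have hne : {p : ℤ × ℤ | len p ≤ propagation F n θ}.Nonempty :=
    (hle (Classical.arbitrary _)).imp fun q hq => hq.2
  obtain ⟨p, hp, hmax⟩ := Set.exists_max_image _ (level θ) (finite_setOf_len_le _) hne
  have hc : ∀ x, Controls F n θ p x := fun x => by
    obtain ⟨q, hq, hq'⟩ := hle x
    exact hq.mono (hmax q hq')
  exact ⟨p, hc, le_antisymm hp (propagation_le_len hF hc)⟩

theorem propagation_nonneg (hF : IsCellularAutomaton F) (n : ℕ) (θ : ℝ) :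
    0 ≤ propagation F n θ := by
  obtain ⟨p, -, hp⟩ := exists_forall_controls_propagation hF n θ
  exact hp ▸ len_nonneg p

theorem localRulesDependOn_level_le_propagation (hF : IsCellularAutomaton F) (n : ℕ) (θ : ℝ) :
    LocalRulesDependOn F n {q | level θ q ≤ propagation F n θ + 2} := by
  obtain ⟨p, hp, hp'⟩ := exists_forall_controls_propagation hF n θ
  refine (localRulesDependOn_of_controls hp).mono fun q hq => hq.out.trans ?_
  rw [← hp']
  gcongr
  exact level_le_len θ p

theorem LocalRulesDependOn.propagation_le (hF : IsCellularAutomaton F) {n : ℕ} {θ c : ℝ}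
    (h : LocalRulesDependOn F n {q | level θ q ≤ c}) (hc : 0 ≤ c) : propagation F n θ ≤ c + 4 := by
  obtain ⟨p, hp, hp'⟩ := exists_le_level_len_le θ (by linarith : 0 ≤ c + 2)
  exact (propagation_le_len hF (h.controls hF (by linarith) hp)).trans (by linarith)

theorem subadditive_propagation (hF : IsCellularAutomaton F) (θ : ℝ) :
    Subadditive fun n => propagation F n θ := by
  intro m n
  obtain ⟨p, hp, hp'⟩ := exists_forall_controls_propagation hF m θ
  obtain ⟨q, hq, hq'⟩ := exists_forall_controls_propagation hF n θ
  simp only [← hp', ← hq']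
  exact (propagation_le_len hF (Controls.add hF hp hq)).trans
    ((len_add_le q p).trans_eq (add_comm _ _))

theorem two_cos_mul_level (φ t : ℝ) (q : ℤ × ℤ) :
    2 * Real.cos t * level φ q = level (φ + t) q + level (φ - t) q := by
  simp only [level, Real.cos_add, Real.cos_sub, Real.sin_add, Real.sin_sub]
  ring

theorem two_cos_mul_propagation_le (hF : IsCellularAutomaton F) (n : ℕ) (φ : ℝ) {t : ℝ}
    (ht : 0 < Real.cos t) : 2 * Real.cos t * propagation F n φ ≤
      propagation F n (φ + t) + propagation F n (φ - t) + (4 + 8 * Real.cos t) := by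
  have hadd := propagation_nonneg hF n (φ + t)
  have hsub := propagation_nonneg hF n (φ - t)
  have hrules : LocalRulesDependOn F n {q | level φ q ≤
      (propagation F n (φ + t) + propagation F n (φ - t) + 4) / (2 * Real.cos t)} := by
    refine ((localRulesDependOn_level_le_propagation hF n (φ + t)).inter
      (localRulesDependOn_level_le_propagation hF n (φ - t))).mono fun q ⟨hq, hq'⟩ => ?_
    rw [Set.mem_ofPred_eq] at hq hq' ⊢
    rw [le_div_iff₀' (by positivity), two_cos_mul_level]
    linarith
  have hle := hrules.propagation_le hF (by positivity)
  rw [← sub_le_iff_le_add, le_div_iff₀' (by positivity)] at hle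
  linarith

theorem exists_propagation_le_add_abs_sub (hF : IsCellularAutomaton F) :
    ∃ R, 0 ≤ R ∧ ∀ (n : ℕ) (θ η : ℝ),
      propagation F n θ ≤ propagation F n η + R * n * |θ - η| + 6 := by
  obtain ⟨R, hR, h⟩ := exists_localRulesDependOn_len_le hF
  refine ⟨R, hR, fun n θ η => ?_⟩
  have hη := propagation_nonneg hF n η
  have hrules : LocalRulesDependOn F n
      {q | level θ q ≤ propagation F n η + 2 + R * n * |θ - η|} := by
    refine ((localRulesDependOn_level_le_propagation hF n η).inter (h n)).mono fun q ⟨hq, hq'⟩ => ?_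
    rw [Set.mem_ofPred_eq] at hq hq' ⊢
    calc level θ q ≤ level η q + |θ - η| * len q := level_le_level_add θ η q
      _ ≤ propagation F n η + 2 + |θ - η| * (R * n) := by gcongr
      _ = _ := by rw [mul_comm |θ - η|]
  linarith [hrules.propagation_le hF (by positivity)]

end Propagation

section Lyapunov

variable {A : Type*}

theorem lyapunov_periodic (F : Config A → Config A) :
    Function.Periodic (lyapunov F) (2 * Real.pi) := fun θ => by
  have hhalf : halfPlane (θ + 2 * Real.pi) = halfPlane θ := by
    unfold halfPlane
    rw [Real.cos_add_two_pi, Real.sin_add_two_pi]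
  have hat : ∀ n, propagationAt F n (θ + 2 * Real.pi) = propagationAt F n θ := fun n =>
    funext fun x => by
      simp only [propagationAt, propagationRadii, agreeSet, hhalf, Real.cos_add_two_pi,
        Real.sin_add_two_pi]
  simp only [lyapunov, propagation, hat]

variable [TopologicalSpace A] [DiscreteTopology A] [Finite A] [Nonempty A] {F : Config A → Config A}

theorem tendsto_lyapunov (hF : IsCellularAutomaton F) (θ : ℝ) :
    Tendsto (fun n : ℕ => propagation F n θ / n) atTop (𝓝 (lyapunov F θ)) :=
  tendsto_nhds_limUnder ⟨_, (subadditive_propagation hF θ).tendsto_lim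
    ⟨0, Set.forall_mem_range.2 fun n => div_nonneg (propagation_nonneg hF n θ) n.cast_nonneg⟩⟩

theorem lyapunov_nonneg (hF : IsCellularAutomaton F) (θ : ℝ) : 0 ≤ lyapunov F θ :=
  ge_of_tendsto' (tendsto_lyapunov hF θ) fun n =>
    div_nonneg (propagation_nonneg hF n θ) n.cast_nonneg

theorem exists_lipschitzWith_lyapunov (hF : IsCellularAutomaton F) :
    ∃ C, LipschitzWith C (lyapunov F) := by
  obtain ⟨R, hR, h⟩ := exists_propagation_le_add_abs_sub hF
  lift R to NNReal using hR
  refine ⟨R, LipschitzWith.of_le_add_mul _ fun θ η => ?_⟩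
  have hlim : Tendsto (fun n : ℕ => propagation F n η / n + R * |θ - η| + 6 / n) atTop
      (𝓝 (lyapunov F η + R * |θ - η| + 0)) :=
    ((tendsto_lyapunov hF η).add_const _).add (tendsto_const_div_atTop_nhds_zero_nat 6)
  rw [add_zero] at hlim
  refine le_of_tendsto_of_tendsto (tendsto_lyapunov hF θ) hlim ?_
  filter_upwards [eventually_gt_atTop 0] with n hn
  rw [div_le_iff₀ (by positivity)]
  refine (h n θ η).trans_eq ?_
  field_simp

theorem continuous_lyapunov (hF : IsCellularAutomaton F) : Continuous (lyapunov F) :=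
  (exists_lipschitzWith_lyapunov hF).choose_spec.continuous

end Lyapunov

section TrigMidconvex

/-- The inequality satisfied by the support function of a planar convex body, as a function of the
angle of the direction: `2 cos t` times the unit vector of angle `φ` is the sum of the unit vectors
of angles `φ + t` and `φ - t`. -/
def IsTrigMidconvex (g : ℝ → ℝ) : Prop :=
  ∀ φ t, 0 < Real.cos t → 2 * Real.cos t * g φ ≤ g (φ + t) + g (φ - t)

theorem isTrigMidconvex_lyapunov {A : Type*} [TopologicalSpace A] [DiscreteTopology A] [Finite A]
    [Nonempty A] {F : Config A → Config A} (hF : IsCellularAutomaton F) :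
    IsTrigMidconvex (lyapunov F) := fun φ t ht => by
  have hlim : Tendsto (fun n : ℕ => propagation F n (φ + t) / n + propagation F n (φ - t) / n +
      (4 + 8 * Real.cos t) / n) atTop (𝓝 (lyapunov F (φ + t) + lyapunov F (φ - t) + 0)) :=
    ((tendsto_lyapunov hF _).add (tendsto_lyapunov hF _)).add
      (tendsto_const_div_atTop_nhds_zero_nat _)
  rw [add_zero] at hlim
  refine le_of_tendsto_of_tendsto' ((tendsto_lyapunov hF φ).const_mul _) hlim fun n => ?_
  rw [← mul_div_assoc, ← add_div, ← add_div]
  exact div_le_div_of_nonneg_right (two_cos_mul_propagation_le hF n φ ht) n.cast_nonneg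

variable {g : ℝ → ℝ}

theorem IsTrigMidconvex.two_mul_sin_mul_le_integral (hg : IsTrigMidconvex g) (hc : Continuous g)
    (φ : ℝ) {a : ℝ} (ha : 0 ≤ a) (ha' : a < Real.pi / 2) :
    2 * Real.sin a * g φ ≤ ∫ θ in (φ - a)..(φ + a), g θ := by
  have hadd : ∫ t in (-a)..a, g (φ + t) = ∫ θ in (φ - a)..(φ + a), g θ := by
    rw [intervalIntegral.integral_comp_add_left g φ, sub_eq_add_neg]
  have hsub : ∫ t in (-a)..a, g (φ - t) = ∫ θ in (φ - a)..(φ + a), g θ := by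
    rw [intervalIntegral.integral_comp_sub_left g φ, sub_neg_eq_add]
  have hcos : ∫ t in (-a)..a, 2 * Real.cos t * g φ = 2 * (2 * Real.sin a * g φ) := by
    rw [intervalIntegral.integral_mul_const, intervalIntegral.integral_const_mul, integral_cos,
      Real.sin_neg]
    ring
  have hmono : ∫ t in (-a)..a, 2 * Real.cos t * g φ ≤ ∫ t in (-a)..a, (g (φ + t) + g (φ - t)) :=
    intervalIntegral.integral_mono_on (by linarith)
      (Continuous.intervalIntegrable (by fun_prop) _ _)
      (Continuous.intervalIntegrable (by fun_prop) _ _) fun t ht =>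
        hg φ t (Real.cos_pos_of_mem_Ioo ⟨by linarith [ht.1], by linarith [ht.2]⟩)
  rw [intervalIntegral.integral_add (Continuous.intervalIntegrable (by fun_prop) _ _)
    (Continuous.intervalIntegrable (by fun_prop) _ _), hadd, hsub, hcos] at hmono
  linarith

theorem IsTrigMidconvex.two_mul_sin_mul_sum_le_integral (hg : IsTrigMidconvex g)
    (hc : Continuous g) (hper : Function.Periodic g (2 * Real.pi)) {N : ℕ} (hN : 2 < N) :
    2 * Real.sin (Real.pi / N) * ∑ i ∈ Finset.range N, g (2 * Real.pi * i / N) ≤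
      ∫ θ in (0 : ℝ)..(2 * Real.pi), g θ := by
  have hN' : (2 : ℝ) < N := by exact_mod_cast hN
  have hangle : Real.pi / N < Real.pi / 2 := by gcongr
  let a : ℕ → ℝ := fun i => 2 * Real.pi * i / N - Real.pi / N
  have ha : ∀ i, a (i + 1) = 2 * Real.pi * i / N + Real.pi / N := fun i => by
    simp only [a, Nat.cast_succ]
    ring
  have haN : a N = a 0 + 2 * Real.pi := by
    simp only [a, Nat.cast_zero]
    field_simp
    ring
  calc 2 * Real.sin (Real.pi / N) * ∑ i ∈ Finset.range N, g (2 * Real.pi * i / N)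
      = ∑ i ∈ Finset.range N, 2 * Real.sin (Real.pi / N) * g (2 * Real.pi * i / N) :=
        Finset.mul_sum ..
    _ ≤ ∑ i ∈ Finset.range N, ∫ θ in (a i)..(a (i + 1)), g θ :=
        Finset.sum_le_sum fun i _ =>
          ha i ▸ hg.two_mul_sin_mul_le_integral hc _ (by positivity) hangle
    _ = ∫ θ in (a 0)..(a N), g θ :=
        intervalIntegral.sum_integral_adjacent_intervals fun i _ => hc.intervalIntegrable _ _
    _ = ∫ θ in (0 : ℝ)..(2 * Real.pi), g θ := by
        rw [haN, hper.intervalIntegral_add_eq (a 0) 0, zero_add]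

theorem IsTrigMidconvex.sqrt_two_mul_sum_le_integral (hg : IsTrigMidconvex g)
    (hc : Continuous g) (hper : Function.Periodic g (2 * Real.pi)) :
    √2 * (g 0 + g Real.pi + (g (Real.pi / 2) + g (Real.pi / 2 + Real.pi))) ≤
      ∫ θ in (0 : ℝ)..(2 * Real.pi), g θ := by
  refine (hg.two_mul_sin_mul_sum_le_integral hc hper (N := 4) (by norm_num)).trans_eq' ?_
  have h1 : 2 * Real.pi * 1 / 4 = Real.pi / 2 := by ring
  have h2 : 2 * Real.pi * 2 / 4 = Real.pi := by ring
  have h3 : 2 * Real.pi * 3 / 4 = Real.pi / 2 + Real.pi := by ring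
  simp only [Finset.sum_range_succ, Finset.sum_range_zero, Nat.cast_ofNat, Nat.cast_zero,
    Nat.cast_one, mul_zero, zero_div, h1, h2, h3, Real.sin_pi_div_four]
  ring

theorem sqrt_two_mul_integral_le (hc : Continuous g) :
    √2 * ∫ θ in (0 : ℝ)..(2 * Real.pi), g θ ≤ (∫ θ in (0 : ℝ)..(2 * Real.pi), g θ ^ 2 / 2) +
      √2 * (∫ θ in (0 : ℝ)..Real.pi, g θ) + Real.pi := by
  have hi : ∀ a b : ℝ, IntervalIntegrable g volume a b := fun a b => hc.intervalIntegrable a b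
  have hi2 : ∀ a b : ℝ, IntervalIntegrable (fun θ => g θ ^ 2 / 2) volume a b :=
    fun a b => Continuous.intervalIntegrable (by fun_prop) a b
  have hpi := Real.pi_pos
  have hfirst : 0 ≤ ∫ θ in (0 : ℝ)..Real.pi, g θ ^ 2 / 2 :=
    intervalIntegral.integral_nonneg hpi.le fun _ _ => by positivity
  have hsecond : ∫ θ in Real.pi..(2 * Real.pi), (√2 * g θ - 1) ≤
      ∫ θ in Real.pi..(2 * Real.pi), g θ ^ 2 / 2 := by
    refine intervalIntegral.integral_mono_on (by linarith)
      (((hi _ _).const_mul _).sub intervalIntegrable_const) (hi2 _ _) fun θ _ => ?_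
    nlinarith [sq_nonneg (g θ - √2), Real.sq_sqrt (by norm_num : (0 : ℝ) ≤ 2)]
  rw [intervalIntegral.integral_sub ((hi _ _).const_mul _) intervalIntegrable_const,
    intervalIntegral.integral_const_mul, intervalIntegral.integral_const, smul_eq_mul] at hsecond
  rw [← intervalIntegral.integral_add_adjacent_intervals (hi 0 Real.pi) (hi _ (2 * Real.pi)),
    ← intervalIntegral.integral_add_adjacent_intervals (hi2 0 Real.pi) (hi2 _ (2 * Real.pi))]
  linarith

end TrigMidconvex

section LyapunovBound

/-- The width in direction `θ` of the planar convex set that contains, in the limit, the rescaled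
neighbourhoods on which the iterates of `F` depend: the sum of its support function at `θ` and at
the opposite direction. -/
noncomputable def lyapunovWidth {A : Type*} (F : Config A → Config A) (θ : ℝ) : ℝ :=
  lyapunov F θ + lyapunov F (θ + Real.pi)

variable {A : Type*} [TopologicalSpace A] [DiscreteTopology A] [Finite A] [Nonempty A]
  {F : Config A → Config A}

theorem lyapunovWidth_nonneg (hF : IsCellularAutomaton F) (θ : ℝ) : 0 ≤ lyapunovWidth F θ :=
  add_nonneg (lyapunov_nonneg hF θ) (lyapunov_nonneg hF (θ + Real.pi))

theorem two_mul_lyapunovWidth_add_le_lyapunovBound (hF : IsCellularAutomaton F) :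
    2 * (lyapunovWidth F 0 + lyapunovWidth F (Real.pi / 2)) ≤ lyapunovBound F := by
  have hc := continuous_lyapunov hF
  have hsum := (isTrigMidconvex_lyapunov hF).sqrt_two_mul_sum_le_integral hc (lyapunov_periodic F)
  rw [lyapunovWidth, lyapunovWidth, zero_add]
  calc _ = √2 * (√2 * _) := by rw [← mul_assoc, Real.mul_self_sqrt zero_le_two]
    _ ≤ √2 * ∫ θ in (0 : ℝ)..(2 * Real.pi), lyapunov F θ := by gcongr
    _ ≤ lyapunovBound F := sqrt_two_mul_integral_le hc

theorem lyapunovBound_nonneg (hF : IsCellularAutomaton F) : 0 ≤ lyapunovBound F :=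
  have hwidth := lyapunovWidth_nonneg hF
  (mul_nonneg zero_le_two (add_nonneg (hwidth _) (hwidth _))).trans
    (two_mul_lyapunovWidth_add_le_lyapunovBound hF)

end LyapunovBound

section Width

variable {A : Type*} {F : Config A → Config A}

/-- The sum of the propagation speeds `Λ_n^F` in the directions `θ` and `θ + π`. -/
noncomputable def propagationWidth (F : Config A → Config A) (n : ℕ) (θ : ℝ) : ℝ :=
  propagation F n θ + propagation F n (θ + Real.pi)

theorem level_add_pi (θ : ℝ) (q : ℤ × ℤ) : level (θ + Real.pi) q = -level θ q := by
  simp only [level, Real.cos_add_pi, Real.sin_add_pi]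
  ring

theorem exists_Ico_of_le {r s : ℝ} (hr : 0 ≤ r) (hs : 0 ≤ s) :
    ∃ (z : ℤ) (a : ℕ), a ≤ r + s + 1 ∧
      ∀ i : ℤ, (i : ℝ) ≤ r → -(i : ℝ) ≤ s → i ∈ Set.Ico z (z + a) := by
  refine ⟨-⌊s⌋₊, ⌊r⌋₊ + ⌊s⌋₊ + 1, ?_, fun i hir his => ?_⟩
  · push_cast
    gcongr <;> exact Nat.floor_le ‹_›
  · have hir := Int.le_floor.2 hir
    have his : -i ≤ ⌊s⌋ := Int.le_floor.2 (by exact_mod_cast his)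
    rw [← Int.natCast_floor_eq_floor hr] at hir
    rw [← Int.natCast_floor_eq_floor hs] at his
    rw [Set.mem_Ico]
    omega

variable [TopologicalSpace A] [DiscreteTopology A] [Finite A] [Nonempty A]

theorem tendsto_propagationWidth_div (hF : IsCellularAutomaton F) (θ : ℝ) :
    Tendsto (fun n : ℕ => propagationWidth F n θ / n) atTop (𝓝 (lyapunovWidth F θ)) := by
  simp only [propagationWidth, add_div]
  exact (tendsto_lyapunov hF θ).add (tendsto_lyapunov hF (θ + Real.pi))

theorem exists_localRulesDependOn_rect (hF : IsCellularAutomaton F) (n : ℕ) :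
    ∃ (p : ℤ × ℤ) (a b : ℕ), a ≤ propagationWidth F n 0 + 5 ∧
      b ≤ propagationWidth F n (Real.pi / 2) + 5 ∧ LocalRulesDependOn F n (rect p a b) := by
  have hnonneg : ∀ θ, 0 ≤ propagation F n θ + 2 := fun θ =>
    add_nonneg (propagation_nonneg hF n θ) zero_le_two
  obtain ⟨i, a, ha, hi⟩ := exists_Ico_of_le (hnonneg 0) (hnonneg (0 + Real.pi))
  obtain ⟨j, b, hb, hj⟩ :=
    exists_Ico_of_le (hnonneg (Real.pi / 2)) (hnonneg (Real.pi / 2 + Real.pi))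
  refine ⟨(i, j), a, b, ha.trans_eq (by rw [propagationWidth]; ring),
    hb.trans_eq (by rw [propagationWidth]; ring), ?_⟩
  have hrules := localRulesDependOn_level_le_propagation hF n
  refine (((hrules 0).inter (hrules (0 + Real.pi))).inter
    ((hrules (Real.pi / 2)).inter (hrules (Real.pi / 2 + Real.pi)))).mono ?_
  rintro q ⟨⟨hright, hleft⟩, hup, hdown⟩
  have level_zero_angle : level 0 q = q.1 := by simp [level]
  have level_pi_div_two : level (Real.pi / 2) q = q.2 := by simp [level]
  simp only [Set.mem_ofPred_eq, level_add_pi, level_zero_angle, level_pi_div_two]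
    at hright hleft hup hdown
  exact mem_rect.2 ⟨hi _ hright hleft, hj _ hup hdown⟩

end Width

section EntropyBound

theorem liminf_le_of_tendsto_of_le {α : Type*} [CompleteLinearOrder α] [TopologicalSpace α]
    [OrderTopology α] {u v : ℕ → α} {n : ℕ → ℕ} {l : α} (hn : Tendsto n atTop atTop)
    (hv : Tendsto v atTop (𝓝 l)) (h : ∀ᶠ m in atTop, u (n m) ≤ v m) : liminf u atTop ≤ l :=
  calc liminf u atTop ≤ liminf u (map n atTop) := liminf_le_liminf_of_le hn
    _ ≤ liminf v atTop := liminf_le_liminf h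
    _ = l := hv.liminf_eq

variable {A : Type*} [Fintype A] [TopologicalSpace A] [MeasurableSpace A]
  [MeasurableSingletonClass A] {F : Config A → Config A} {μ : Measure (Config A)}
  [IsProbabilityMeasure μ]

theorem entropySeq_squarePartition_le_windowEntropy (hF : IsCellularAutomaton F) {m : ℕ}
    {p : ℤ × ℤ} {a b : ℕ} (h : LocalRulesDependOn F m (rect p a b)) (n : ℕ) :
    entropySeq μ F (squarePartition n) m ≤
      windowEntropy μ centralPartition (rect p (a + n) (b + n)) / m := by
  refine div_le_div_of_nonneg_right (partitionEntropy_le_jointEntropy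
    (fun q => measurable_centralPartition.comp (measurable_translate q))
    fun x y hxy => funext fun k => funext fun v => ?_) m.cast_nonneg
  refine h.iterate_apply_eq hF k.2.le fun q hq => ?_
  have hq := mem_rect.1 hq
  have hsum : q + (((v.1 : ℕ) : ℤ), ((v.2 : ℕ) : ℤ)) ∈ rect p (a + n) (b + n) := by
    simp only [mem_rect, Prod.fst_add, Prod.snd_add]
    omega
  simpa only [centralPartition, Function.comp_apply, ← Prod.zero_eq_mk, translate_apply_zero]
    using hxy _ hsum

variable [DiscreteTopology A]

theorem entropyOf_squarePartition_le (hF : IsCellularAutomaton F)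
    (h₁ : MeasurePreserving shift₁ μ μ) (h₂ : MeasurePreserving shift₂ μ μ)
    (hμF : MeasurePreserving F μ μ) {k m : ℕ} (hk : 0 < k) (hm : 0 < m) (n : ℕ) :
    entropyOf μ F (squarePartition n) ≤ (n + (propagationWidth F m 0 + (5 + k))) *
      (n + (propagationWidth F m (Real.pi / 2) + (5 + k))) *
      shiftEntropySeq μ (centralPartition (A := A)) k / m := by
  have : Nonempty A := (nonempty_of_isProbabilityMeasure μ).map centralPartition
  obtain ⟨p, a, b, ha, hb, hrect⟩ := exists_localRulesDependOn_rect hF m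
  have hS := shiftEntropySeq_nonneg (μ := μ) (centralPartition (A := A)) k
  refine (entropyOf_le_entropySeq hμF (measurable_squarePartition n) hm.ne').trans
    ((entropySeq_squarePartition_le_windowEntropy hF hrect n).trans ?_)
  gcongr
  refine (windowEntropy_rect_le h₁ h₂ measurable_centralPartition p _ _ hk).trans ?_
  push_cast
  gcongr ?_ * ?_ * _ <;> linarith

theorem alwaysFiniteEntropy_le_mul_shiftEntropySeq (hF : IsCellularAutomaton F)
    (h₁ : MeasurePreserving shift₁ μ μ) (h₂ : MeasurePreserving shift₂ μ μ)
    (hμF : MeasurePreserving F μ μ) {c : ℝ} (hc : 0 < c) {k : ℕ} (hk : 0 < k) :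
    alwaysFiniteEntropy μ F ≤ (((c + lyapunovWidth F 0) * (c + lyapunovWidth F (Real.pi / 2)) *
      shiftEntropySeq μ (centralPartition (A := A)) k / c : ℝ) : EReal) := by
  have : Nonempty A := (nonempty_of_isProbabilityMeasure μ).map centralPartition
  let n : ℕ → ℕ := fun m => ⌈c * (m : ℝ)⌉₊
  have hn : Tendsto n atTop atTop :=
    tendsto_nat_ceil_atTop.comp (tendsto_natCast_atTop_atTop.const_mul_atTop hc)
  have hn_div : Tendsto (fun m : ℕ => (n m : ℝ) / m) atTop (𝓝 c) :=
    (tendsto_nat_ceil_mul_div_atTop hc.le).comp tendsto_natCast_atTop_atTop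
  have hside : ∀ θ, Tendsto (fun m : ℕ => (n m + (propagationWidth F m θ + (5 + k))) / m) atTop
      (𝓝 (c + lyapunovWidth F θ)) := fun θ => by
    simpa only [add_div _ _ (Nat.cast _), add_zero] using hn_div.add
      ((tendsto_propagationWidth_div hF θ).add (tendsto_const_div_atTop_nhds_zero_nat (5 + k : ℝ)))
  have hlim := (((hside 0).mul (hside (Real.pi / 2))).mul_const
    (shiftEntropySeq μ (centralPartition (A := A)) k)).div hn_div hc.ne'
  refine liminf_le_of_tendsto_of_le hn ((continuous_coe_real_ereal.tendsto _).comp hlim) ?_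
  filter_upwards [eventually_gt_atTop 0, hn.eventually_gt_atTop 0] with m hm hnm
  refine EReal.coe_le_coe_iff.2 ((div_le_div_of_nonneg_right
    (entropyOf_squarePartition_le hF h₁ h₂ hμF hk hm _) (Nat.cast_nonneg _)).trans_eq ?_)
  simp only [Pi.div_apply]
  field_simp

theorem alwaysFiniteEntropy_le_mul_shiftEntropyOf (hF : IsCellularAutomaton F)
    (h₁ : MeasurePreserving shift₁ μ μ) (h₂ : MeasurePreserving shift₂ μ μ)
    (hμF : MeasurePreserving F μ μ) {c : ℝ} (hc : 0 < c) :
    alwaysFiniteEntropy μ F ≤ (((c + lyapunovWidth F 0) * (c + lyapunovWidth F (Real.pi / 2)) *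
      shiftEntropyOf μ (centralPartition (A := A)) / c : ℝ) : EReal) := by
  refine ge_of_tendsto ((continuous_coe_real_ereal.tendsto _).comp
    (((tendsto_shiftEntropySeq h₁ h₂ measurable_centralPartition).const_mul _).div_const c)) ?_
  filter_upwards [eventually_gt_atTop 0] with k hk
  exact alwaysFiniteEntropy_le_mul_shiftEntropySeq hF h₁ h₂ hμF hc hk

theorem alwaysFiniteEntropy_le_lyapunovWidth (hF : IsCellularAutomaton F)
    (h₁ : MeasurePreserving shift₁ μ μ) (h₂ : MeasurePreserving shift₂ μ μ)
    (hμF : MeasurePreserving F μ μ) :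
    alwaysFiniteEntropy μ F ≤ ((shiftEntropyOf μ (centralPartition (A := A)) *
      (2 * (lyapunovWidth F 0 + lyapunovWidth F (Real.pi / 2))) : ℝ) : EReal) := by
  have : Nonempty A := (nonempty_of_isProbabilityMeasure μ).map centralPartition
  have hw := lyapunovWidth_nonneg hF 0
  have hv := lyapunovWidth_nonneg hF (Real.pi / 2)
  have hS := shiftEntropyOf_nonneg h₁ h₂ (measurable_centralPartition (A := A))
  set w := lyapunovWidth F 0
  set v := lyapunovWidth F (Real.pi / 2)
  set S := shiftEntropyOf μ (centralPartition (A := A))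
  have hcont : Continuous fun c : ℝ => ((S * (2 * (c + v)) : ℝ) : EReal) :=
    continuous_coe_real_ereal.comp (by fun_prop)
  refine ge_of_tendsto (hcont.continuousWithinAt (s := Set.Ioi w)) ?_
  filter_upwards [self_mem_nhdsWithin] with c hwc
  have hwc : w < c := hwc
  refine (alwaysFiniteEntropy_le_mul_shiftEntropyOf hF h₁ h₂ hμF (hw.trans_lt hwc)).trans
    (EReal.coe_le_coe_iff.2 ?_)
  rw [div_le_iff₀ (hw.trans_lt hwc)]
  calc (c + w) * (c + v) * S ≤ (c + c) * (c + v) * S := by gcongr; linarith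
    _ = S * (2 * (c + v)) * c := by ring

theorem alwaysFiniteEntropy_le_lyapunovBound (hF : IsCellularAutomaton F)
    (h₁ : MeasurePreserving shift₁ μ μ) (h₂ : MeasurePreserving shift₂ μ μ)
    (hμF : MeasurePreserving F μ μ) :
    alwaysFiniteEntropy μ F ≤
      ((shiftEntropyOf μ (centralPartition (A := A)) * lyapunovBound F : ℝ) : EReal) := by
  have : Nonempty A := (nonempty_of_isProbabilityMeasure μ).map centralPartition
  refine (alwaysFiniteEntropy_le_lyapunovWidth hF h₁ h₂ hμF).trans (EReal.coe_le_coe_iff.2 ?_)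
  exact mul_le_mul_of_nonneg_left (two_mul_lyapunovWidth_add_le_lyapunovBound hF)
    (shiftEntropyOf_nonneg h₁ h₂ measurable_centralPartition)

end EntropyBound

end CA2D

theorem theorem1_general {A : Type*} [Fintype A] [TopologicalSpace A] [DiscreteTopology A]
    [MeasurableSpace A] [MeasurableSingletonClass A]
    (F : CA2D.Config A → CA2D.Config A) (hF : CA2D.IsCellularAutomaton F)
    (μ : Measure (CA2D.Config A)) [IsProbabilityMeasure μ]
    (h₁ : MeasurePreserving CA2D.shift₁ μ μ) (h₂ : MeasurePreserving CA2D.shift₂ μ μ)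
    (hμF : MeasurePreserving F μ μ) :
    (∀ n : ℕ, Tendsto (CA2D.entropySeq μ F (CA2D.squarePartition n)) atTop
      (𝓝 (CA2D.entropyOf μ F (CA2D.squarePartition n)))) ∧
    (∀ (m : ℕ) (f : CA2D.Config A → Fin m), Measurable f →
      Tendsto (CA2D.shiftEntropySeq μ f) atTop (𝓝 (CA2D.shiftEntropyOf μ f))) ∧
    (∀ (n : ℕ) (θ : ℝ) (x : CA2D.Config A),
      IsLeast (CA2D.propagationRadii F n θ x) (CA2D.propagationAt F n θ x)) ∧
    (∀ (n : ℕ) (θ : ℝ),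
      IsGreatest (Set.range (CA2D.propagationAt F n θ)) (CA2D.propagation F n θ)) ∧
    (∀ θ : ℝ, Tendsto (fun n : ℕ => CA2D.propagation F n θ / n) atTop
      (𝓝 (CA2D.lyapunov F θ))) ∧
    Continuous (CA2D.lyapunov F) ∧
    CA2D.alwaysFiniteEntropy μ F ≤
      ((CA2D.shiftEntropyOf μ (CA2D.centralPartition (A := A)) * CA2D.lyapunovBound F : ℝ) :
        EReal) ∧
    CA2D.alwaysFiniteEntropy μ F ≤
      CA2D.shiftEntropy μ * ((CA2D.lyapunovBound F : ℝ) : EReal) := by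
  have : Nonempty A := (nonempty_of_isProbabilityMeasure μ).map CA2D.centralPartition
  have hbound := CA2D.alwaysFiniteEntropy_le_lyapunovBound hF h₁ h₂ hμF
  have hsup : ((CA2D.shiftEntropyOf μ (CA2D.centralPartition (A := A)) * CA2D.lyapunovBound F : ℝ) :
      EReal) ≤ CA2D.shiftEntropy μ * ((CA2D.lyapunovBound F : ℝ) : EReal) := by
    rw [EReal.coe_mul]
    exact mul_le_mul_of_nonneg_right
      (CA2D.shiftEntropyOf_le_shiftEntropy CA2D.measurable_centralPartition)
      (EReal.coe_nonneg.2 (CA2D.lyapunovBound_nonneg hF))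
  exact ⟨fun n => CA2D.tendsto_entropySeq hμF (CA2D.measurable_squarePartition n),
    fun m f => CA2D.tendsto_shiftEntropySeq h₁ h₂, CA2D.isLeast_propagationAt hF,
    CA2D.isGreatest_propagation hF, CA2D.tendsto_lyapunov hF, CA2D.continuous_lyapunov hF,
    hbound, hbound.trans hsup⟩

theorem theorem1 {A : Type*} [Fintype A] [TopologicalSpace A] [DiscreteTopology A]
    [MeasurableSpace A] [MeasurableSingletonClass A]
    (F : CA2D.Config A → CA2D.Config A) (hF : CA2D.IsCellularAutomaton F)
    (μ : Measure (CA2D.Config A)) [IsProbabilityMeasure μ]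
    (hσ : CA2D.IsShiftErgodic μ) (hμF : MeasurePreserving F μ μ) :
    -- the limits, minima and maxima that define the quantities exist, and `λ` is continuous
    (∀ n : ℕ, Tendsto (CA2D.entropySeq μ F (CA2D.squarePartition n)) atTop
      (𝓝 (CA2D.entropyOf μ F (CA2D.squarePartition n)))) ∧
    (∀ (m : ℕ) (f : CA2D.Config A → Fin m), Measurable f →
      Tendsto (CA2D.shiftEntropySeq μ f) atTop (𝓝 (CA2D.shiftEntropyOf μ f))) ∧
    (∀ (n : ℕ) (θ : ℝ) (x : CA2D.Config A),
      IsLeast (CA2D.propagationRadii F n θ x) (CA2D.propagationAt F n θ x)) ∧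
    (∀ (n : ℕ) (θ : ℝ),
      IsGreatest (Set.range (CA2D.propagationAt F n θ)) (CA2D.propagation F n θ)) ∧
    (∀ θ : ℝ, Tendsto (fun n : ℕ => CA2D.propagation F n θ / n) atTop
      (𝓝 (CA2D.lyapunov F θ))) ∧
    Continuous (CA2D.lyapunov F) ∧
    -- the inequality, with the entropy of the central partition and with that of the action
    CA2D.alwaysFiniteEntropy μ F ≤
      ((CA2D.shiftEntropyOf μ (CA2D.centralPartition (A := A)) * CA2D.lyapunovBound F : ℝ) :
        EReal) ∧
    CA2D.alwaysFiniteEntropy μ F ≤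
      CA2D.shiftEntropy μ * ((CA2D.lyapunovBound F : ℝ) : EReal) :=
  theorem1_general F hF μ hσ.measurePreserving₁ hσ.measurePreserving₂ hμF
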